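/- Messages are built from variables and aliases with the function symbols $\langle\cdot,\cdot\rangle,\mathrm{fst},\mathrm{snd},\mathrm{enc},\mathrm{dec},\mathrm{mac}$ modulo the congruence $=_E$ generated by $\mathrm{fst}\langle M,N\rangle=M$, $\mathrm{snd}\langle M,N\rangle=N$, $\mathrm{dec}(\mathrm{enc}(M,K),K)=M$. Processes of the applied $\pi$-calculus, $P::=0\mid\nu x.P\mid P|P\mid{!P}\mid[M=N]P\mid M(x).P\mid\overline M\langle N\rangle.P\mid P+P$ (choice between guarded processes only), are identified up to $\alpha$-conversion. Extended processes $\nu\vec x.(\sigma\mid P)$ carry an active substitution $\sigma$ from located aliases $\alpha=s\lambda$ ($s\in\{0,1\}^*$, $\lambda$ an alias variable) to messages; $\mathrm{dom}$ of an extended process is $\mathrm{dom}\,\sigma$. They have the early non-interleaving transitions $A\xrightarrow{\pi}_{u}B$, whose events $(\pi,u)$ consist of an action $\pi$ (an input $M\,N$, an output $\overline M(\alpha)$ with $\alpha$ fresh, or $\tau$; messages in labels are recipes over public variables and $\mathrm{dom}\,A$) and a location label $u$: a location $s[t]$, where $s$ records the path through parallel compositions ($!P$ unfolds to $P|{!P}$)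 and $t$ the choices taken, or, for $\tau$, the pair of the locations of an output and of an input. Locations with prefix strings $s,s'$ are structurally independent if neither of $s,s'$ is a prefix of the other; location labels are so if all their components are pairwise. Two events are independent if their location labels are structurally independent and, whenever one of them is an output $\overline M(\alpha)$, $\alpha$ does not occur free in the action of the other (the alias bound by an output is not free in it). $A\vDash M=N$ means $M\sigma=_EN\sigma$, where $A=\nu\vec x.(\sigma\mid P)$ with $\vec x$ not free in $M,N$. An HP-simulation is a relation $A\,\mathcal R^{\rho,S}B$ on extended processes, indexed by a bijection $\rho:\mathrm{dom}\,A\to\mathrm{dom}\,B$ and a relation $S$ over events, such that whenever $A\,\mathcal R^{\rho,S_1\cup S_2}B$: (1) if $A\xrightarrow{\pi}_{u}A'$, $\pi$ is not an output, and $(\pi,u)$ is independent of every event in $\mathrm{dom}\,S_1$ and of none in $\mathrm{dom}\,S_2$, then there are $B',u'$ with $B\xrightarrow{\pi\rho}_{u'}B'$, $(\pi\rho,u')$ independent of every event in $\mathrm{ran}\,S_1$ and of none in $\mathrm{ran}\,S_2$, and $A'\,\mathcal R^{\rho,\,S_1\cup\{((\pi,u),(\pi\rho,u'))\}}B'$;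 (2) likewise for outputs $A\xrightarrow{\overline M(\alpha)}_{u}A'$, answered by some $B\xrightarrow{\overline{M\rho}(\alpha')}_{u'}B'$, with $\rho$ updated to $\rho[\alpha\mapsto\alpha']$ and the pair of these two events added to $S_1$; (3) $A\vDash M=N$ iff $B\vDash M\rho=N\rho$, for all messages $M,N$ with aliases in $\mathrm{dom}\,A$. $A$ and $B$ are HP-bisimilar, $A\sim_{HP}B$, if $A\,\mathcal R^{\mathrm{id},\emptyset}B$ for some HP-simulation $\mathcal R$ that is symmetric ($A\,\mathcal R^{\rho,S}B$ iff $B\,\mathcal R^{\rho^{-1},S^{-1}}A$). A process $P$ stands for $\mathrm{id}\mid P$. Let $c\neq d$ be public (free) variables. For the BAC protocol let $$V(c,d,ke,km)=d(nt).\nu nr.\nu kr.\,\overline c\langle\langle m,\mathrm{mac}(m,km)\rangle\rangle,\quad m=\mathrm{enc}(\langle nr,\langle nt,kr\rangle\rangle,ke),$$ $$P(c,d,ke,km)=\nu nt.\overline c\langle nt\rangle.d(y).[\mathrm{snd}\,y=\mathrm{mac}(\mathrm{fst}\,y,km)]\,[nt=\mathrm{fst}(\mathrm{snd}(\mathrm{dec}(\mathrm{fst}\,y,ke)))]\,\nu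 kt.\,\overline c\langle\langle m',\mathrm{mac}(m',km)\rangle\rangle,$$ $$m'=\mathrm{enc}(\langle nt,\langle\mathrm{fst}(\mathrm{dec}(\mathrm{fst}\,y,ke)),kt\rangle\rangle,ke),$$ $$\mathrm{System}_{\min}={!\nu ke,km.!}(V(c,d,ke,km)\mid P(c,d,ke,km)),\quad \mathrm{Spec}_{\min}={!\nu ke,km.}(V(c,d,ke,km)\mid P(c,d,ke,km)).$$ For the Feldhofer protocol let $$V^F(c,d,k)=d(nt).\nu nr.\overline c\langle\mathrm{enc}(\langle nr,nt\rangle,k)\rangle,\quad P^F(c,d,k)=\nu nt.\overline c\langle nt\rangle.d(y).[nt=\mathrm{snd}(\mathrm{dec}(y,k))]\,\overline c\langle\mathrm{enc}(\langle nt,\mathrm{fst}(\mathrm{dec}(y,k))\rangle,k)\rangle,$$ $$\mathrm{System}^F_{\min}={!\nu k.!}(V^F(c,d,k)\mid P^F(c,d,k)),\quad \mathrm{Spec}^F_{\min}={!\nu k.}(V^F(c,d,k)\mid P^F(c,d,k)).$$ Theorem. $\mathrm{System}_{\min}\not\sim_{HP}\mathrm{Spec}_{\min}$, and likewise $\mathrm{System}^F_{\min}\not\sim_{HP}\mathrm{Spec}^F_{\min}$.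 -/

import Mathlib

/-!
The applied pi-calculus with guarded choice and located aliases, its early non-interleaving
structural operational semantics, history-preserving bisimilarity, and the minimal unlinkability
systems for the BAC and the Feldhofer protocol.

Variables (names) are de Bruijn indices, so that terms are identified up to alpha-conversion:
`nu` and the input prefix bind index `0`; indices that are not bound are free (public) variables.
A freshness side condition "x is not free in X" then says that `X`, seen under the binder `x`,
is a renamed copy `X.rename Nat.succ` of a term from outside that binder.
-/

namespace APi

/-- A location prefix string over `{0, 1}` (`false` is `0`, `true` is `1`). -/
abbrev Str : Type := List Bool

/-- Located aliases `sλ`: a prefix string `s` and an alias variable `λ`. -/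
abbrev Alias : Type := Str × ℕ

/-! ### Messages -/

/-- Messages over the signature of pairing, projections, symmetric encryption and MAC. -/
inductive Msg : Type
  | var (x : ℕ)
  | als (a : Alias)
  | pair (M N : Msg)
  | fst (M : Msg)
  | snd (M : Msg)
  | enc (M K : Msg)
  | dec (M K : Msg)
  | mac (M K : Msg)

/-- Substitution of messages for variables. -/
def Msg.subst (f : ℕ → Msg) : Msg → Msg
  | .var x => f x
  | .als a => .als a
  | .pair M N => .pair (M.subst f) (N.subst f)
  | .fst M => .fst (M.subst f)
  | .snd M => .snd (M.subst f)
  | .enc M K => .enc (M.subst f) (K.subst f)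
  | .dec M K => .dec (M.subst f) (K.subst f)
  | .mac M K => .mac (M.subst f) (K.subst f)

/-- Renaming of variables. -/
def Msg.rename (r : ℕ → ℕ) (M : Msg) : Msg := M.subst (fun x => .var (r x))

/-- Substitution of messages for aliases. -/
def Msg.substAls (f : Alias → Msg) : Msg → Msg
  | .var x => .var x
  | .als a => f a
  | .pair M N => .pair (M.substAls f) (N.substAls f)
  | .fst M => .fst (M.substAls f)
  | .snd M => .snd (M.substAls f)
  | .enc M K => .enc (M.substAls f) (K.substAls f)
  | .dec M K => .dec (M.substAls f) (K.substAls f)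
  | .mac M K => .mac (M.substAls f) (K.substAls f)

/-- The free aliases of a message. -/
def Msg.fal : Msg → Set Alias
  | .var _ => ∅
  | .als a => {a}
  | .pair M N => M.fal ∪ N.fal
  | .fst M => M.fal
  | .snd M => M.fal
  | .enc M K => M.fal ∪ K.fal
  | .dec M K => M.fal ∪ K.fal
  | .mac M K => M.fal ∪ K.fal

/-- The equational theory `=_E` of pairs and symmetric encryption: the least congruence with
`fst ⟨M, N⟩ = M`, `snd ⟨M, N⟩ = N` and `dec (enc M K) K = M`. -/
inductive EqE : Msg → Msg → Prop
  | refl (M : Msg) : EqE M M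
  | symm {M N : Msg} : EqE M N → EqE N M
  | trans {M N K : Msg} : EqE M N → EqE N K → EqE M K
  | pair {M M' N N' : Msg} : EqE M M' → EqE N N' → EqE (.pair M N) (.pair M' N')
  | fst {M M' : Msg} : EqE M M' → EqE (.fst M) (.fst M')
  | snd {M M' : Msg} : EqE M M' → EqE (.snd M) (.snd M')
  | enc {M M' K K' : Msg} : EqE M M' → EqE K K' → EqE (.enc M K) (.enc M' K')
  | dec {M M' K K' : Msg} : EqE M M' → EqE K K' → EqE (.dec M K) (.dec M' K')
  | mac {M M' K K' : Msg} : EqE M M' → EqE K K' → EqE (.mac M K) (.mac M' K')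
  | fst_pair (M N : Msg) : EqE (.fst (.pair M N)) M
  | snd_pair (M N : Msg) : EqE (.snd (.pair M N)) N
  | dec_enc (M K : Msg) : EqE (.dec (.enc M K) K) M

/-! ### Processes -/

/-- Processes. The guarded processes are those built by `inp`, `out`, `mat`, `nu` and `sum` from
input and output prefixes; `sum` is meant for guarded summands, and only moves of summands
that happen at a location `[t]` with empty prefix string (as every move of a guarded process
does) give rise to moves of a choice. -/
inductive Proc : Type
  | nil
  | nu (P : Proc)
  | par (P Q : Proc)
  | bang (P : Proc)
  | mat (M N : Msg) (P : Proc)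
  | inp (M : Msg) (P : Proc)
  | out (M N : Msg) (P : Proc)
  | sum (P Q : Proc)

/-- Lifting of a substitution under one binder. -/
def liftSubst (f : ℕ → Msg) : ℕ → Msg
  | 0 => .var 0
  | n + 1 => (f n).rename Nat.succ

/-- Capture-avoiding substitution of messages for variables. -/
def Proc.subst (f : ℕ → Msg) : Proc → Proc
  | .nil => .nil
  | .nu P => .nu (P.subst (liftSubst f))
  | .par P Q => .par (P.subst f) (Q.subst f)
  | .bang P => .bang (P.subst f)
  | .mat M N P => .mat (M.subst f) (N.subst f) (P.subst f)
  | .inp M P => .inp (M.subst f) (P.subst (liftSubst f))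
  | .out M N P => .out (M.subst f) (N.subst f) (P.subst f)
  | .sum P Q => .sum (P.subst f) (Q.subst f)

/-- The substitution of `N` for the variable `0` when its binder is removed. -/
def instSubst (N : Msg) : ℕ → Msg
  | 0 => N
  | n + 1 => .var n

/-- `M` seen under `n` further binders. -/
def Msg.shift (n : ℕ) (M : Msg) : Msg := M.rename (fun x => x + n)

/-- `P` seen under `n` further binders. -/
def Proc.shift (n : ℕ) (P : Proc) : Proc := P.subst (fun x => .var (x + n))

/-! ### Extended processes -/

/-- Active substitutions: partial maps from aliases to messages. Aliases on which the partial map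
is undefined are mapped to themselves. -/
abbrev ASubst : Type := Alias → Option Msg

/-- The identity substitution. -/
def ASubst.id : ASubst := fun _ => none

/-- The domain of a substitution. -/
def ASubst.dom (σ : ASubst) : Set Alias := {a | (σ a).isSome}

/-- The extension `σ ∘ {N/α}` of a substitution by an alias that is fresh for its domain. -/
noncomputable def ASubst.extend (σ : ASubst) (a : Alias) (N : Msg) : ASubst :=
  Function.update σ a (some N)

/-- `σ` seen under `n` further binders. -/
def ASubst.shift (n : ℕ) (σ : ASubst) : ASubst := fun a => (σ a).map (Msg.shift n)

/-- `Mσ` -/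
def Msg.app (M : Msg) (σ : ASubst) : Msg := M.substAls (fun a => (σ a).getD (.als a))

/-- The extended process `νx₁ … νxₙ.(σ | P)`, with `n = binders`. The bound variables are the
indices `0, …, n - 1` in `σ` and `P` (the innermost binder is `0`), so `νx.A` has the same `sub` and `proc` as `A` and one more
binder. -/
structure Ext : Type where
  binders : ℕ
  sub : ASubst
  proc : Proc

/-- A process `P` as the extended process `id | P`. -/
def Ext.ofProc (P : Proc) : Ext := ⟨0, ASubst.id, P⟩

/-- The domain of an extended process: the aliases extruded so far. -/
def Ext.dom (A : Ext) : Set Alias := A.sub.dom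

/-- Satisfaction `A ⊨ M = N`. -/
def Ext.Sat (A : Ext) (M N : Msg) : Prop :=
  EqE ((M.shift A.binders).app A.sub) ((N.shift A.binders).app A.sub)

/-! ### Labels -/

/-- Early action labels: free input `M N`, output `M̄(α)`, interaction `τ`. -/
inductive Act : Type
  | inp (M N : Msg)
  | out (M : Msg) (a : Alias)
  | tau

/-- Apply a function to all messages of an action label (an output alias is left unchanged). -/
def Act.map (f : Msg → Msg) : Act → Act
  | .inp M N => .inp (f M) (f N)
  | .out M a => .out (f M) a
  | .tau => .tau

/-- `π` seen under `n` further binders. -/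
def Act.shift (n : ℕ) (π : Act) : Act := π.map (Msg.shift n)

/-- The free aliases of an action label; the alias bound by an output is not counted. -/
def Act.fal : Act → Set Alias
  | .inp M N => M.fal ∪ N.fal
  | .out M _ => M.fal
  | .tau => ∅

/-- The label is an output. -/
def Act.IsOut : Act → Prop
  | .out _ _ => True
  | _ => False

/-- Locations `s[t]`. -/
abbrev Loc : Type := Str × Str

/-- Location labels: a location, or a pair of locations (of an output and of an input). -/
inductive LocLabel : Type
  | one (l : Loc)
  | two (l₀ l₁ : Loc)

/-- `cℓ` for `c ∈ {0, 1}` -/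
def Loc.cons (c : Bool) (l : Loc) : Loc := (c :: l.1, l.2)

/-- `cu` for `c ∈ {0, 1}` -/
def LocLabel.cons (c : Bool) : LocLabel → LocLabel
  | .one l => .one (Loc.cons c l)
  | .two l₀ l₁ => .two (Loc.cons c l₀) (Loc.cons c l₁)

/-- Events: an action label and a location label. -/
abbrev Event : Type := Act × LocLabel

/-! ### Structural operational semantics -/

/-- Transitions `P --π,u--> νx₁ … νxₙ.(σ | R)` of processes. -/
inductive PStep : Proc → Act → LocLabel → Ext → Prop
  | inp {M K : Msg} (N : Msg) {P : Proc} :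
      EqE M K →
      PStep (.inp K P) (.inp M N) (.one ([], [])) ⟨0, ASubst.id, P.subst (instSubst N)⟩
  | out {M K N : Msg} {P : Proc} (l : ℕ) :
      EqE M K →
      PStep (.out K N P) (.out M ([], l)) (.one ([], [])) ⟨0, ASubst.id.extend ([], l) N, P⟩
  | parL {P Q R : Proc} {π : Act} {u : LocLabel} {n : ℕ} {σ : ASubst} :
      PStep P π u ⟨n, σ, R⟩ →
      PStep (.par P Q) π (u.cons false) ⟨n, σ, .par R (Q.shift n)⟩
  | parR {P Q R : Proc} {π : Act} {u : LocLabel} {n : ℕ} {σ : ASubst} :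
      PStep Q π u ⟨n, σ, R⟩ →
      PStep (.par P Q) π (u.cons true) ⟨n, σ, .par (P.shift n) R⟩
  | ext {P R : Proc} {π : Act} {u : LocLabel} {n : ℕ} {σ : ASubst} :
      PStep P (π.shift 1) u ⟨n, σ, R⟩ →
      PStep (.nu P) π u ⟨n + 1, σ, R⟩
  | sumL {P Q : Proc} {π : Act} {t : Str} {A : Ext} :
      PStep P π (.one ([], t)) A →
      PStep (.sum P Q) π (.one ([], false :: t)) A
  | sumR {P Q : Proc} {π : Act} {t : Str} {A : Ext} :
      PStep Q π (.one ([], t)) A →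
      PStep (.sum P Q) π (.one ([], true :: t)) A
  | mat {M N : Msg} {P : Proc} {π : Act} {u : LocLabel} {A : Ext} :
      PStep P π u A → EqE M N →
      PStep (.mat M N P) π u A
  | bang {P : Proc} {π : Act} {u : LocLabel} {A : Ext} :
      PStep (.par P (.bang P)) π u A →
      PStep (.bang P) π u A
  -- In the two rules below the message `N` lives under the binders of the output, hence these
  -- binders are placed outside those of the input (adjacent restrictions may be permuted).
  | closeL {P P' Q Q' : Proc} {M N : Msg} {l : ℕ} {ℓ₀ ℓ₁ : Loc} {n m : ℕ} :
      PStep P (.out M ([], l)) (.one ℓ₀) ⟨n, ASubst.id.extend ([], l) N, P'⟩ →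
      PStep (Q.shift n) (.inp (M.shift n) N) (.one ℓ₁) ⟨m, ASubst.id, Q'⟩ →
      PStep (.par P Q) .tau (.two (Loc.cons false ℓ₀) (Loc.cons true ℓ₁))
        ⟨n + m, ASubst.id, .par (P'.shift m) Q'⟩
  | closeR {P P' Q Q' : Proc} {M N : Msg} {l : ℕ} {ℓ₀ ℓ₁ : Loc} {n m : ℕ} :
      PStep (P.shift n) (.inp (M.shift n) N) (.one ℓ₀) ⟨m, ASubst.id, P'⟩ →
      PStep Q (.out M ([], l)) (.one ℓ₁) ⟨n, ASubst.id.extend ([], l) N, Q'⟩ →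
      PStep (.par P Q) .tau (.two (Loc.cons true ℓ₁) (Loc.cons false ℓ₀))
        ⟨n + m, ASubst.id, .par P' (Q'.shift m)⟩

/-- Transitions `A --π,u--> B` of extended processes. -/
inductive Step : Ext → Act → LocLabel → Ext → Prop
  | aliasOut {σ : ASubst} {P Q : Proc} {M N : Msg} {l : ℕ} {s s' : Str} {n : ℕ} :
      PStep P (.out (M.app σ) ([], l)) (.one (s, s')) ⟨n, ASubst.id.extend ([], l) N, Q⟩ →
      M.fal ⊆ σ.dom → (s, l) ∉ σ.dom →
      Step ⟨0, σ, P⟩ (.out M (s, l)) (.one (s, s')) ⟨n, (σ.shift n).extend (s, l) N, Q⟩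
  | aliasFree {σ : ASubst} {P Q : Proc} {π : Act} {u : LocLabel} {n : ℕ} :
      PStep P (π.map (fun M => M.app σ)) u ⟨n, ASubst.id, Q⟩ →
      π.fal ⊆ σ.dom →
      Step ⟨0, σ, P⟩ π u ⟨n, σ.shift n, Q⟩
  | res {σ θ : ASubst} {P R : Proc} {π : Act} {u : LocLabel} {n m : ℕ} :
      Step ⟨n, σ, P⟩ (π.shift 1) u ⟨m, θ, R⟩ →
      Step ⟨n + 1, σ, P⟩ π u ⟨m + 1, θ, R⟩

/-! ### Independence of events -/

/-- Structural independence of location labels. -/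
inductive LocIndep : LocLabel → LocLabel → Prop
  | left (s p q t t' : Str) :
      LocIndep (.one (s ++ false :: p, t)) (.one (s ++ true :: q, t'))
  | right (s p q t t' : Str) :
      LocIndep (.one (s ++ true :: p, t)) (.one (s ++ false :: q, t'))
  | twoL {l₀ l₁ : Loc} {u : LocLabel} :
      LocIndep (.one l₀) u → LocIndep (.one l₁) u → LocIndep (.two l₀ l₁) u
  | twoR {l₀ l₁ : Loc} {u : LocLabel} :
      LocIndep u (.one l₀) → LocIndep u (.one l₁) → LocIndep u (.two l₀ l₁)

/-- If `π` is an output, then its alias is fresh for `π'`. -/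
def Act.OutFresh : Act → Act → Prop
  | .out _ a, π' => a ∉ π'.fal
  | _, _ => True

/-- Independence of events: structural independence, and no link dependence either way. -/
def Indep (e e' : Event) : Prop :=
  LocIndep e.2 e'.2 ∧ e.1.OutFresh e'.1 ∧ e'.1.OutFresh e.1

/-- `e` is independent of every event of the set. -/
def IndepOfAll (e : Event) (E : Set Event) : Prop := ∀ e' ∈ E, Indep e e'

/-- `e` is independent of no event of the set. -/
def IndepOfNone (e : Event) (E : Set Event) : Prop := ∀ e' ∈ E, ¬ Indep e e'

/-! ### History-preserving bisimilarity -/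

/-- A bijection between two sets of aliases. -/
abbrev AliasBij : Type := Alias ≃. Alias

/-- `ρ` is a bijection from `X` onto `Y`. -/
def AliasBij.Between (ρ : AliasBij) (X Y : Set Alias) : Prop :=
  (∀ a, a ∈ X ↔ (ρ a).isSome) ∧ (∀ b, b ∈ Y ↔ (ρ.symm b).isSome)

/-- `ρ[a ↦ b]` (used for `a` outside the domain and `b` outside the range of `ρ`; in general
the pairs in conflict with `(a, b)` are dropped). -/
def AliasBij.update (ρ : AliasBij) (a b : Alias) : AliasBij where
  toFun x := if x = a then some b else if ρ x = some b then none else ρ x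
  invFun y := if y = b then some a else if ρ.symm y = some a then none else ρ.symm y
  inv x y := by
    have h1 : ρ.symm y = some x ↔ ρ x = some y := ρ.eq_some_iff
    have h2 : ρ.symm y = some a ↔ ρ a = some y := ρ.eq_some_iff
    grind

/-- `Mρ` -/
def Msg.ren (M : Msg) (ρ : AliasBij) : Msg := M.substAls (fun a => .als ((ρ a).getD a))

/-- `πρ`, for labels `π` that are not outputs; for an output `M̄(α)` this is `M̄ρ(α)`. -/
def Act.ren (π : Act) (ρ : AliasBij) : Act := π.map (fun M => M.ren ρ)

/-- Relations over events. -/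
abbrev EvRel : Type := Set (Event × Event)

/-- The domain of a relation over events. -/
def EvRel.dom (S : EvRel) : Set Event := Prod.fst '' S

/-- The range of a relation over events. -/
def EvRel.ran (S : EvRel) : Set Event := Prod.snd '' S

/-- The converse of a relation over events. -/
def EvRel.inv (S : EvRel) : EvRel := Prod.swap '' S

/-- Relations on extended processes indexed by a bijection of aliases and a relation over events:
`R A ρ S B` stands for `A R^{ρ, S} B`. -/
abbrev HPRel : Type := Ext → AliasBij → EvRel → Ext → Prop

/-- `R` is an HP-simulation. -/
structure IsHPSimulation (R : HPRel) : Prop where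
  bij : ∀ {A ρ S B}, R A ρ S B → ρ.Between A.dom B.dom
  free : ∀ {A ρ B} {S₁ S₂ : EvRel}, R A ρ (S₁ ∪ S₂) B →
    ∀ {π u A'}, Step A π u A' → ¬ π.IsOut →
      IndepOfAll (π, u) S₁.dom → IndepOfNone (π, u) S₂.dom →
      ∃ B' u', Step B (π.ren ρ) u' B' ∧
        IndepOfAll (π.ren ρ, u') S₁.ran ∧ IndepOfNone (π.ren ρ, u') S₂.ran ∧
        R A' ρ (S₁ ∪ {((π, u), (π.ren ρ, u'))}) B'
  out : ∀ {A ρ B} {S₁ S₂ : EvRel}, R A ρ (S₁ ∪ S₂) B →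
    ∀ {M a u A'}, Step A (.out M a) u A' →
      IndepOfAll (.out M a, u) S₁.dom → IndepOfNone (.out M a, u) S₂.dom →
      ∃ B' u' a', Step B (.out (M.ren ρ) a') u' B' ∧
        IndepOfAll (.out (M.ren ρ) a', u') S₁.ran ∧
        IndepOfNone (.out (M.ren ρ) a', u') S₂.ran ∧
        R A' (ρ.update a a') (S₁ ∪ {((.out M a, u), (.out (M.ren ρ) a', u'))}) B'
  static : ∀ {A ρ S B}, R A ρ S B → ∀ M N : Msg, M.fal ⊆ A.dom → N.fal ⊆ A.dom →
    (A.Sat M N ↔ B.Sat (M.ren ρ) (N.ren ρ))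

/-- `R` is symmetric. -/
def HPRel.IsSymmetric (R : HPRel) : Prop :=
  ∀ A ρ S B, R A ρ S B ↔ R B ρ.symm (EvRel.inv S) A

open Classical in
/-- HP-bisimilarity: some symmetric HP-simulation relates `A` and `B`, with the identity on the
extruded aliases and the empty relation over events. -/
def HPBisimilar (A B : Ext) : Prop :=
  ∃ R : HPRel, IsHPSimulation R ∧ R.IsSymmetric ∧ R A (PEquiv.ofSet A.dom) ∅ B

/-! ### The BAC protocol

The arguments `c d ke km` are the indices of the channels and keys. Under `k` binders of the
process they become `c + k`, and so on. -/

/-- The BAC verifier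
`V(c,d,ke,km) = d(nt).νnr.νkr. let m = enc(⟨nr,⟨nt,kr⟩⟩,ke) in c̄⟨m, mac(m,km)⟩`. -/
def verifier (c d ke km : ℕ) : Proc :=
  .inp (.var d) <|                            -- nt
  .nu <|                                      -- nr
  .nu <|                                      -- kr, so that kr = 0, nr = 1, nt = 2
  let m : Msg := .enc (.pair (.var 1) (.pair (.var 2) (.var 0))) (.var (ke + 3))
  .out (.var (c + 3)) (.pair m (.mac m (.var (km + 3)))) .nil

/-- The BAC prover
`P(c,d,ke,km) = νnt.c̄⟨nt⟩.d(y).[snd y = mac(fst y,km)][nt = fst(snd(dec(fst y,ke)))]`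
`νkt. let m = enc(⟨nt,⟨fst(dec(fst y,ke)),kt⟩⟩,ke) in c̄⟨m, mac(m,km)⟩`. -/
def prover (c d ke km : ℕ) : Proc :=
  .nu <|                                      -- nt
  .out (.var (c + 1)) (.var 0) <|
  .inp (.var (d + 1)) <|                      -- y, so that y = 0, nt = 1
  .mat (.snd (.var 0)) (.mac (.fst (.var 0)) (.var (km + 2))) <|
  .mat (.var 1) (.fst (.snd (.dec (.fst (.var 0)) (.var (ke + 2))))) <|
  .nu <|                                      -- kt, so that kt = 0, y = 1, nt = 2
  let m : Msg :=
    .enc (.pair (.var 2) (.pair (.fst (.dec (.fst (.var 1)) (.var (ke + 3)))) (.var 0)))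
      (.var (ke + 3))
  .out (.var (c + 3)) (.pair m (.mac m (.var (km + 3)))) .nil

/-- `System_min = !νke.νkm.!(V(c,d,ke,km) | P(c,d,ke,km))` -/
def systemMin (c d : ℕ) : Proc :=
  .bang (.nu (.nu (.bang (.par (verifier (c + 2) (d + 2) 1 0) (prover (c + 2) (d + 2) 1 0)))))

/-- `Spec_min = !νke.νkm.(V(c,d,ke,km) | P(c,d,ke,km))` -/
def specMin (c d : ℕ) : Proc :=
  .bang (.nu (.nu (.par (verifier (c + 2) (d + 2) 1 0) (prover (c + 2) (d + 2) 1 0))))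

/-! ### The Feldhofer protocol -/

/-- The Feldhofer verifier `V(c,d,k) = d(nt).νnr.c̄⟨enc(⟨nr,nt⟩,k)⟩`. -/
def verifierF (c d k : ℕ) : Proc :=
  .inp (.var d) <|                            -- nt
  .nu <|                                      -- nr, so that nr = 0, nt = 1
  .out (.var (c + 2)) (.enc (.pair (.var 0) (.var 1)) (.var (k + 2))) .nil

/-- The Feldhofer prover
`P(c,d,k) = νnt.c̄⟨nt⟩.d(y).[nt = snd(dec(y,k))] c̄⟨enc(⟨nt,fst(dec(y,k))⟩,k)⟩`. -/
def proverF (c d k : ℕ) : Proc :=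
  .nu <|                                      -- nt
  .out (.var (c + 1)) (.var 0) <|
  .inp (.var (d + 1)) <|                      -- y, so that y = 0, nt = 1
  .mat (.var 1) (.snd (.dec (.var 0) (.var (k + 2)))) <|
  .out (.var (c + 2)) (.enc (.pair (.var 1) (.fst (.dec (.var 0) (.var (k + 2))))) (.var (k + 2)))
    .nil

/-- `System_min` for Feldhofer, `!νk.!(V(c,d,k) | P(c,d,k))` -/
def systemMinF (c d : ℕ) : Proc :=
  .bang (.nu (.bang (.par (verifierF (c + 1) (d + 1) 0) (proverF (c + 1) (d + 1) 0))))

/-- `Spec_min` for Feldhofer, `!νk.(V(c,d,k) | P(c,d,k))` -/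
def specMinF (c d : ℕ) : Proc :=
  .bang (.nu (.par (verifierF (c + 1) (d + 1) 0) (proverF (c + 1) (d + 1) 0)))

end APi

/-!
The system is distinguished from the specification by the following game, which is the same for
both protocols.

In the system, a prover sends a nonce, and two verifiers that share its keys are both asked to reply
to this nonce. In the specification some prover sends the nonce, and since replies are outputs that
depend structurally on the preceding input, both replies have to come from verifiers as well: the
prover does not accept its own nonce and hence makes no further output. As every key of the
specification belongs to one verifier only, and each verifier replies once, at least one of the
replies is under a key that differs from that of the prover. (If the first one is, the second is not
even requested.) Now the prover of the system is given this reply, accepts it, and makes its final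
output. The prover of the specification rejects it, so that the specification has to answer by yet
another verifier, and its prover keeps waiting.
At this point the sides are exchanged: the waiting prover of the specification consumes an arbitrary
name, after which it is stuck. In the system no prover is waiting any more, so that the input is
answered by a verifier, whose reply depends on that input and cannot be matched.

The game only uses that an answer to an output depends structurally on the event before it whenever
the output does (`IsHPSimulation.answer_inp_out`), so only pairs of an input and a dependent output
need to be analysed. `InOut` describes these pairs for a process, and its rules for restriction,
parallel composition and replication yield the analysis of the processes `Quiet` (no waiting prover)
and `Around` (one distinguished component among quiet ones). That a prover rejects replies under
other keys follows from the normal forms `Msg.nf`, which are invariant under the equational theory.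
`Protocol` collects what is needed from the concrete protocols, `Protocol.not_bisimilar` plays the
game, and `bac` and `feldhofer` are the two instances.
-/

namespace APi

/-! ### Renaming of variables -/

/-- Lifting of a renaming under one binder. -/
def liftRen (r : ℕ → ℕ) : ℕ → ℕ
  | 0 => 0
  | n + 1 => r n + 1

/-- Renaming of the free variables of a process. -/
def Proc.ren (r : ℕ → ℕ) (P : Proc) : Proc := P.subst (fun x => .var (r x))

theorem liftSubst_var (r : ℕ → ℕ) :
    liftSubst (fun x => .var (r x)) = fun x => .var (liftRen r x) := by
  funext x
  cases x <;> rfl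

theorem Proc.ren_nu (r : ℕ → ℕ) (P : Proc) : (Proc.nu P).ren r = .nu (P.ren (liftRen r)) := by
  simp [Proc.ren, Proc.subst, liftSubst_var]

theorem Msg.rename_rename (r s : ℕ → ℕ) (M : Msg) :
    (M.rename r).rename s = M.rename (fun x => s (r x)) := by
  induction M <;> simp_all [Msg.rename, Msg.subst]

theorem Msg.shift_shift (n m : ℕ) (M : Msg) : (M.shift n).shift m = M.shift (n + m) := by
  simp [Msg.shift, Msg.rename_rename, Nat.add_assoc]

theorem Msg.shift_zero (M : Msg) : M.shift 0 = M := by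
  induction M <;> simp_all [Msg.shift, Msg.rename, Msg.subst]

theorem Msg.fal_shift (n : ℕ) (M : Msg) : (M.shift n).fal = M.fal := by
  induction M <;> simp_all [Msg.shift, Msg.rename, Msg.subst, Msg.fal]

theorem Msg.shift_als (n : ℕ) (a : Alias) : (Msg.als a).shift n = .als a := rfl

theorem Msg.app_als {σ : ASubst} {a : Alias} {N : Msg} (h : σ a = some N) :
    (Msg.als a).app σ = N := by
  simp [Msg.app, Msg.substAls, h]

theorem Proc.ren_ren (r s : ℕ → ℕ) (P : Proc) :
    (P.ren r).ren s = P.ren (fun x => s (r x)) := by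
  have hM : ∀ (r s : ℕ → ℕ) (M : Msg), (M.subst (fun x => .var (r x))).subst (fun x => .var (s x))
      = M.subst (fun x => .var (s (r x))) := Msg.rename_rename
  have hl : ∀ (r s : ℕ → ℕ) (x : ℕ), liftRen s (liftRen r x) = liftRen (fun x => s (r x)) x := by
    intro r s x
    cases x <;> rfl
  induction P generalizing r s <;> simp_all [Proc.ren, Proc.subst, liftSubst_var]

theorem Proc.shift_eq_ren (n : ℕ) (P : Proc) : P.shift n = P.ren (fun x => x + n) := rfl

theorem Proc.shift_shift (n m : ℕ) (P : Proc) : (P.shift n).shift m = P.shift (n + m) := by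
  simp [Proc.shift_eq_ren, Proc.ren_ren, Nat.add_assoc]

theorem Proc.ren_id (P : Proc) : P.ren (fun x => x) = P := by
  have hM : ∀ M : Msg, M.subst Msg.var = M := Msg.shift_zero
  have hl : liftSubst (fun x => .var x) = fun x => .var x := by
    funext x
    cases x <;> rfl
  induction P <;> simp_all [Proc.ren, Proc.subst]

theorem Proc.shift_zero (P : Proc) : P.shift 0 = P := Proc.ren_id P

theorem Act.shift_shift (n m : ℕ) (π : Act) : (π.shift n).shift m = π.shift (n + m) := by
  cases π <;> simp [Act.shift, Act.map, Msg.shift_shift]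

theorem Act.shift_zero (π : Act) : π.shift 0 = π := by
  cases π <;> simp [Act.shift, Act.map, Msg.shift_zero]

/-! ### Active substitutions -/

theorem ASubst.dom_shift (σ : ASubst) (n : ℕ) : (σ.shift n).dom = σ.dom := by
  ext a
  simp [ASubst.dom, ASubst.shift]

theorem ASubst.shift_shift (σ : ASubst) (n m : ℕ) :
    (σ.shift n).shift m = σ.shift (n + m) := by
  funext a
  simp [ASubst.shift, Function.comp_def, Msg.shift_shift]

theorem ASubst.shift_zero (σ : ASubst) : σ.shift 0 = σ := by
  funext a
  have : Msg.shift 0 = fun M => M := funext Msg.shift_zero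
  simp [ASubst.shift, this]

theorem ASubst.extend_inj {σ : ASubst} {a : Alias} {M N : Msg}
    (h : σ.extend a M = σ.extend a N) : M = N := by
  have := congrFun h a
  simpa [ASubst.extend] using this

theorem ASubst.extend_same (σ : ASubst) (a : Alias) (N : Msg) : (σ.extend a N) a = some N := by
  simp [ASubst.extend]

/-- Values of the substitution persist, seen under the new binders, when a fresh alias is added. -/
theorem ASubst.extend_shift_of_eq {σ : ASubst} {a b : Alias} {M : Msg} (N : Msg) (n : ℕ)
    (hb : σ b = some M) (ha : a ∉ σ.dom) : ((σ.shift n).extend a N) b = some (M.shift n) := by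
  have hba : b ≠ a := by
    rintro rfl
    exact ha (by simp [ASubst.dom, hb])
  simp [ASubst.extend, Function.update_of_ne hba, ASubst.shift, hb]

theorem ASubst.dom_extend_shift_finite {σ : ASubst} (h : σ.dom.Finite) (n : ℕ) (a : Alias)
    (N : Msg) : ((σ.shift n).extend a N).dom.Finite := by
  refine (h.insert a).subset fun b hb => ?_
  by_cases hba : b = a
  · exact Or.inl hba
  · right
    simpa [ASubst.dom, ASubst.extend, Function.update_of_ne hba, ASubst.shift] using hb

/-! ### Normal forms of messages -/

open Classical in
/-- The normal form of a message for the rewrite system that orients the equations from left to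
right. It is computed innermost first, so that it is invariant under the equations by definition. -/
noncomputable def Msg.nf : Msg → Msg
  | .var x => .var x
  | .als a => .als a
  | .pair M N => .pair M.nf N.nf
  | .fst M => match M.nf with
    | .pair A _ => A
    | T => .fst T
  | .snd M => match M.nf with
    | .pair _ B => B
    | T => .snd T
  | .enc M K => .enc M.nf K.nf
  | .dec M K => match M.nf with
    | .enc A L => if L = K.nf then A else .dec (.enc A L) K.nf
    | T => .dec T K.nf
  | .mac M K => .mac M.nf K.nf

theorem EqE.nf_eq {M N : Msg} (h : EqE M N) : M.nf = N.nf := by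
  induction h with
  | dec _ _ h1 h2 => rw [Msg.nf, Msg.nf, h1, h2]
  | _ => simp_all [Msg.nf]

/-! ### Labels of transitions -/

/-- An input does not extend the active substitution, and it happens at a single location. -/
theorem PStep.sub_of_inp {P : Proc} {π : Act} {u : LocLabel} {A : Ext} (h : PStep P π u A) :
    ∀ M N, π = .inp M N → A.sub = ASubst.id ∧ ∃ l, u = .one l := by
  induction h with
  | inp N hE => exact fun _ _ _ => ⟨rfl, _, rfl⟩
  | out l hE => simp
  | parL h ih | parR h ih =>
    intro M N hπ
    obtain ⟨h1, l, rfl⟩ := ih M N hπ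
    exact ⟨h1, _, rfl⟩
  | ext h ih =>
    rintro M N rfl
    exact ih (M.shift 1) (N.shift 1) rfl
  | sumL h ih | sumR h ih =>
    intro M N hπ
    exact ⟨(ih M N hπ).1, _, rfl⟩
  | mat h hE ih => exact ih
  | bang h ih => exact ih
  | closeL | closeR => simp

/-- An output adds exactly its alias to the active substitution, and it happens at a single
location. -/
theorem PStep.sub_of_out {P : Proc} {π : Act} {u : LocLabel} {A : Ext} (h : PStep P π u A) :
    ∀ M a, π = .out M a → (∃ N, A.sub = ASubst.id.extend a N) ∧ a.1 = [] ∧ ∃ l, u = .one l := by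
  induction h with
  | inp N hE => simp
  | out l hE =>
    intro M a hπ
    cases hπ
    exact ⟨⟨_, rfl⟩, rfl, _, rfl⟩
  | parL h ih | parR h ih =>
    intro M N hπ
    obtain ⟨h1, h2, l, rfl⟩ := ih M N hπ
    exact ⟨h1, h2, _, rfl⟩
  | ext h ih =>
    rintro M a rfl
    exact ih (M.shift 1) a rfl
  | sumL h ih | sumR h ih =>
    intro M N hπ
    exact ⟨(ih M N hπ).1, (ih M N hπ).2.1, _, rfl⟩
  | mat h hE ih => exact ih
  | bang h ih => exact ih
  | closeL | closeR => simp

/-- An input of an extended process is an input of its process, with the messages of the label under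
the restrictions and the active substitution. -/
theorem Step.inp_inv {A B : Ext} {π : Act} {u : LocLabel} (h : Step A π u B) :
    ∀ M N, π = .inp M N → ∃ m R,
      PStep A.proc (.inp ((M.shift A.binders).app A.sub) ((N.shift A.binders).app A.sub)) u
        ⟨m, ASubst.id, R⟩ ∧
      M.fal ⊆ A.dom ∧ N.fal ⊆ A.dom ∧ B = ⟨m + A.binders, A.sub.shift m, R⟩ := by
  induction h with
  | aliasOut => simp
  | aliasFree h hf =>
    rintro M N rfl
    refine ⟨_, _, ?_, fun a ha => hf (Or.inl ha), fun a ha => hf (Or.inr ha), rfl⟩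
    simpa [Act.map, Msg.shift_zero] using h
  | res h ih =>
    rintro M N rfl
    obtain ⟨k, R', h1, h2, h3, h4⟩ := ih (M.shift 1) (N.shift 1) rfl
    simp only [Msg.fal_shift, Msg.shift_shift, Nat.add_comm 1] at h1 h2 h3
    refine ⟨k, R', h1, h2, h3, ?_⟩
    simp only [Ext.mk.injEq] at h4 ⊢
    exact ⟨by omega, h4.2⟩

/-- An output of an extended process is an output of its process. The alias is fresh, and it is
added to the active substitution. -/
theorem Step.out_inv {A B : Ext} {π : Act} {u : LocLabel} (h : Step A π u B) :
    ∀ M a, π = .out M a → ∃ m y R,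
      PStep A.proc (.out ((M.shift A.binders).app A.sub) ([], a.2)) u
        ⟨m, ASubst.id.extend ([], a.2) y, R⟩ ∧
      a ∉ A.dom ∧ B = ⟨m + A.binders, (A.sub.shift m).extend a y, R⟩ := by
  induction h with
  | aliasOut h hf ha =>
    intro M a hπ
    cases hπ
    refine ⟨_, _, _, ?_, ha, rfl⟩
    simpa [Msg.shift_zero] using h
  | aliasFree h hf =>
    -- an output would extend the identity substitution
    rintro M a rfl
    obtain ⟨⟨y, hy⟩, -⟩ := h.sub_of_out _ _ rfl
    have := congrFun hy a
    simp [ASubst.extend, ASubst.id] at this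
  | res h ih =>
    rintro M a rfl
    obtain ⟨k, y, R', h1, h2, h4⟩ := ih (M.shift 1) a rfl
    simp only [Msg.shift_shift, Nat.add_comm 1] at h1
    refine ⟨k, y, R', h1, h2, ?_⟩
    simp only [Ext.mk.injEq] at h4 ⊢
    exact ⟨by omega, h4.2⟩

theorem Step.of_inp {n m : ℕ} {σ : ASubst} {P R : Proc} {M N : Msg} {u : LocLabel}
    (h : PStep P (.inp ((M.shift n).app σ) ((N.shift n).app σ)) u ⟨m, ASubst.id, R⟩)
    (hM : M.fal ⊆ σ.dom) (hN : N.fal ⊆ σ.dom) :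
    Step ⟨n, σ, P⟩ (.inp M N) u ⟨m + n, σ.shift m, R⟩ := by
  induction n generalizing M N with
  | zero =>
    rw [Msg.shift_zero, Msg.shift_zero] at h
    exact .aliasFree (π := .inp M N) h (Set.union_subset hM hN)
  | succ n ih =>
    refine .res (ih (M := M.shift 1) (N := N.shift 1) ?_ ?_ ?_)
    · simpa only [Msg.shift_shift, Nat.add_comm 1] using h
    · rwa [Msg.fal_shift]
    · rwa [Msg.fal_shift]

theorem Step.of_out {n m : ℕ} {σ : ASubst} {P R : Proc} {M y : Msg} {s t : Str} {l : ℕ}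
    (h : PStep P (.out ((M.shift n).app σ) ([], l)) (.one (s, t))
      ⟨m, ASubst.id.extend ([], l) y, R⟩)
    (hM : M.fal ⊆ σ.dom) (ha : (s, l) ∉ σ.dom) :
    Step ⟨n, σ, P⟩ (.out M (s, l)) (.one (s, t)) ⟨m + n, (σ.shift m).extend (s, l) y, R⟩ := by
  induction n generalizing M with
  | zero =>
    rw [Msg.shift_zero] at h
    exact .aliasOut h hM ha
  | succ n ih =>
    refine .res (π := .out M (s, l)) (ih (M := M.shift 1) ?_ ?_)
    · simpa only [Msg.shift_shift, Nat.add_comm 1] using h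
    · rwa [Msg.fal_shift]

/-! ### Independence of locations -/

theorem LocIndep.cons {u v : LocLabel} (h : LocIndep u v) (b : Bool) :
    LocIndep (u.cons b) (v.cons b) := by
  induction h with
  | left s p q t t' => exact .left (b :: s) p q t t'
  | right s p q t t' => exact .right (b :: s) p q t t'
  | twoL _ _ h1 h2 => exact .twoL h1 h2
  | twoR _ _ h1 h2 => exact .twoR h1 h2

theorem LocIndep.irrefl (l : Loc) : ¬ LocIndep (.one l) (.one l) := by
  have key : ∀ {u v : LocLabel}, LocIndep u v → u = .one l → v ≠ .one l := by
    intro u v h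
    cases h with
    | left | right =>
      intro h1 h2
      simpa using h1.trans h2.symm
    | twoL => simp
    | twoR => simp
  exact fun h => key h rfl rfl

theorem LocIndep.cons_ne {l l' : Loc} {b b' : Bool} (h : b ≠ b') :
    LocIndep ((LocLabel.one l).cons b) ((LocLabel.one l').cons b') := by
  obtain ⟨s, t⟩ := l
  obtain ⟨s', t'⟩ := l'
  cases b <;> cases b' <;> simp at h
  · exact .left [] s s' t t'
  · exact .right [] s s' t t'

/-! ### Transitions of restrictions and replications -/

/-- `n` restrictions in front of a process. -/
def nus : ℕ → Proc → Proc
  | 0, P => P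
  | n + 1, P => .nu (nus n P)

theorem PStep.nus_inv {j : ℕ} {Q : Proc} {π : Act} {u : LocLabel} {A : Ext}
    (h : PStep (nus j Q) π u A) :
    ∃ n, A.binders = n + j ∧ PStep Q (π.shift j) u ⟨n, A.sub, A.proc⟩ := by
  induction j generalizing π A with
  | zero => exact ⟨_, rfl, by rwa [Act.shift_zero]⟩
  | succ j ih =>
    cases h with
    | ext h =>
      obtain ⟨n, h1, h2⟩ := ih h
      simp only at h1
      exact ⟨n, by simp only; omega, by rwa [Act.shift_shift, Nat.add_comm 1] at h2⟩

theorem PStep.nus {j n : ℕ} {Q R : Proc} {π : Act} {u : LocLabel} {σ : ASubst}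
    (h : PStep Q (π.shift j) u ⟨n, σ, R⟩) : PStep (nus j Q) π u ⟨n + j, σ, R⟩ := by
  induction j generalizing π with
  | zero => rwa [Act.shift_zero] at h
  | succ j ih =>
    refine .ext (ih ?_)
    rwa [Act.shift_shift, Nat.add_comm 1]

/-- A replication moves by one of its copies, unless two copies interact: a property of the moves
of `!P` may be proved by induction on the index of the copy that moves. -/
theorem PStep.bang_induction {P : Proc} {Φ : Act → LocLabel → Ext → Prop}
    (hL : ∀ {π u n σ R}, PStep P π u ⟨n, σ, R⟩ →
      Φ π (u.cons false) ⟨n, σ, .par R ((Proc.bang P).shift n)⟩)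
    (hR : ∀ {π u n σ R}, PStep (.bang P) π u ⟨n, σ, R⟩ → Φ π u ⟨n, σ, R⟩ →
      Φ π (u.cons true) ⟨n, σ, .par (P.shift n) R⟩)
    {π : Act} {u : LocLabel} {A : Ext} (h : PStep (.bang P) π u A) (hπ : π ≠ .tau) :
    Φ π u A := by
  have key : ∀ {Q π u A}, PStep Q π u A → π ≠ .tau →
      (Q = .bang P → Φ π u A) ∧ (Q = .par P (.bang P) → Φ π u A) := by
    intro Q π u A h
    induction h with
    | parL h ih =>
      refine fun _ => ⟨by simp, fun hQ => ?_⟩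
      cases hQ
      exact hL h
    | parR h ih =>
      refine fun hπ => ⟨by simp, fun hQ => ?_⟩
      cases hQ
      exact hR h ((ih hπ).1 rfl)
    | bang h ih =>
      refine fun hπ => ⟨fun hQ => ?_, by simp⟩
      cases hQ
      exact (ih hπ).2 rfl
    | closeL | closeR => exact fun hπ => absurd rfl hπ
    | _ => simp
  exact (key h hπ).1 rfl

/-! ### Inputs that are followed by an output at the same place -/

/-- Whenever `Q` inputs `N` and then makes an output that depends structurally on this input, the
output message `y` and the residual `R` satisfy `Post n y R`, where `n` counts the restrictions
that the two moves have opened. -/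
def InOut (Q : Proc) (N : Msg) (Post : ℕ → Msg → Proc → Prop) : Prop :=
  ∀ ⦃M u A⦄, PStep Q (.inp M N) u A → ∀ ⦃M' a u' B⦄, PStep A.proc (.out M' a) u' B →
    ¬ LocIndep u' u → ∃ y, B.sub = ASubst.id.extend a y ∧ Post (A.binders + B.binders) y B.proc

theorem InOut.mono {Q : Proc} {N : Msg} {Post Post' : ℕ → Msg → Proc → Prop}
    (h : InOut Q N Post) (hP : ∀ n y R, Post n y R → Post' n y R) : InOut Q N Post' := by
  intro M u A h1 M' a u' B h2 hu
  obtain ⟨y, hy, hpost⟩ := h h1 h2 hu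
  exact ⟨y, hy, hP _ _ _ hpost⟩

/-- After an input by the left component, only this component makes outputs that depend on it. -/
theorem InOut.parL_step {Q Q' : Proc} {N M : Msg} {Post : ℕ → Msg → Proc → Prop}
    {n : ℕ} {σ : ASubst} {R : Proc} {u : LocLabel}
    (h1 : PStep Q (.inp M N) u ⟨n, σ, R⟩)
    (h : ∀ ⦃M' a u' B⦄, PStep R (.out M' a) u' B →
      ¬ LocIndep u' u → ∃ y, B.sub = ASubst.id.extend a y ∧
        Post (n + B.binders) y (.par B.proc (Q'.shift (n + B.binders)))) :
    ∀ ⦃M' a u' B⦄, PStep (.par R (Q'.shift n)) (.out M' a) u' B →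
      ¬ LocIndep u' (u.cons false) → ∃ y, B.sub = ASubst.id.extend a y ∧
        Post (n + B.binders) y B.proc := by
  intro M' a u' B h2 hu
  cases h2 with
  | parL h2 =>
    rw [Proc.shift_shift]
    exact h h2 fun hi => hu (hi.cons false)
  | parR h2 =>
    obtain ⟨-, l, rfl⟩ := h1.sub_of_inp _ _ rfl
    obtain ⟨-, -, l', rfl⟩ := h2.sub_of_out _ _ rfl
    exact absurd (LocIndep.cons_ne (by simp)) hu

/-- After an input by the right component, only this component makes outputs that depend on it. -/
theorem InOut.parR_step {Q Q' : Proc} {N M : Msg} {Post : ℕ → Msg → Proc → Prop}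
    {n : ℕ} {σ : ASubst} {R : Proc} {u : LocLabel}
    (h1 : PStep Q (.inp M N) u ⟨n, σ, R⟩)
    (h : ∀ ⦃M' a u' B⦄, PStep R (.out M' a) u' B →
      ¬ LocIndep u' u → ∃ y, B.sub = ASubst.id.extend a y ∧
        Post (n + B.binders) y (.par (Q'.shift (n + B.binders)) B.proc)) :
    ∀ ⦃M' a u' B⦄, PStep (.par (Q'.shift n) R) (.out M' a) u' B →
      ¬ LocIndep u' (u.cons true) → ∃ y, B.sub = ASubst.id.extend a y ∧
        Post (n + B.binders) y B.proc := by
  intro M' a u' B h2 hu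
  cases h2 with
  | parR h2 =>
    rw [Proc.shift_shift]
    exact h h2 fun hi => hu (hi.cons true)
  | parL h2 =>
    obtain ⟨-, l, rfl⟩ := h1.sub_of_inp _ _ rfl
    obtain ⟨-, -, l', rfl⟩ := h2.sub_of_out _ _ rfl
    exact absurd (LocIndep.cons_ne (by simp)) hu

theorem InOut.par {Q Q' : Proc} {N : Msg} {Post : ℕ → Msg → Proc → Prop}
    (h : InOut Q N fun n y R => Post n y (.par R (Q'.shift n)))
    (h' : InOut Q' N fun n y R => Post n y (.par (Q.shift n) R)) :
    InOut (.par Q Q') N Post := by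
  intro M u A h1
  cases h1 with
  | parL h1 => exact InOut.parL_step h1 (h h1)
  | parR h1 => exact InOut.parR_step h1 (h' h1)

theorem InOut.bang {Q : Proc} {N : Msg} {Post : ℕ → Msg → Proc → Prop}
    (h : InOut Q N fun n y R => Post n y (.par R ((Proc.bang Q).shift n)))
    (h' : ∀ n y R, Post n y R → Post n y (.par (Q.shift n) R)) :
    InOut (.bang Q) N Post := by
  intro M u A h1
  refine PStep.bang_induction (P := Q) (Φ := fun π u A => ∀ M, π = .inp M N →
    ∀ ⦃M' a u' B⦄, PStep A.proc (.out M' a) u' B → ¬ LocIndep u' u →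
      ∃ y, B.sub = ASubst.id.extend a y ∧ Post (A.binders + B.binders) y B.proc)
    ?_ ?_ h1 (by simp) M rfl
  · rintro π u n σ R h1 M rfl
    exact InOut.parL_step h1 (h h1)
  · rintro π u n σ R h1 ih M rfl
    refine InOut.parR_step h1 fun _ _ _ _ h2 hu => ?_
    obtain ⟨y, hy, hpost⟩ := ih M rfl h2 hu
    exact ⟨y, hy, h' _ _ _ hpost⟩

theorem InOut.nu {Q : Proc} {N : Msg} {Post : ℕ → Msg → Proc → Prop}
    (h : InOut Q (N.shift 1) fun n => Post (n + 1)) : InOut (.nu Q) N Post := by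
  intro M u A h1
  cases h1 with
  | ext h1 =>
    intro M' a u' B h2 hu
    obtain ⟨y, hy, hpost⟩ := h h1 h2 hu
    refine ⟨y, hy, ?_⟩
    rwa [Nat.add_right_comm]

/-- Every input of `Q` enables an output on channel `c` at the same place. -/
def CanReply (c : ℕ) (Q : Proc) : Prop :=
  ∀ ⦃M N u A⦄, PStep Q (.inp M N) u A → ∃ m y R, ∀ l,
    PStep A.proc (.out (.var (c + A.binders)) ([], l)) u ⟨m, ASubst.id.extend ([], l) y, R⟩

theorem CanReply.par {c : ℕ} {Q Q' : Proc} (h : CanReply c Q) (h' : CanReply c Q') :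
    CanReply c (.par Q Q') := by
  intro M N u A h1
  cases h1 with
  | parL h1 =>
    obtain ⟨m, y, R, h2⟩ := h h1
    exact ⟨m, y, _, fun l => .parL (h2 l)⟩
  | parR h1 =>
    obtain ⟨m, y, R, h2⟩ := h' h1
    exact ⟨m, y, _, fun l => .parR (h2 l)⟩

theorem CanReply.bang {c : ℕ} {Q : Proc} (h : CanReply c Q) : CanReply c (.bang Q) := by
  intro M N u A h1
  refine PStep.bang_induction (P := Q) (Φ := fun π u A => ∀ M, π = .inp M N → ∃ m y R, ∀ l,
    PStep A.proc (.out (.var (c + A.binders)) ([], l)) u ⟨m, ASubst.id.extend ([], l) y, R⟩)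
    ?_ ?_ h1 (by simp) M rfl
  · rintro π u n σ R h1 M rfl
    obtain ⟨m, y, R, h2⟩ := h h1
    exact ⟨m, y, _, fun l => .parL (h2 l)⟩
  · rintro π u n σ R h1 ih M rfl
    obtain ⟨m, y, R, h2⟩ := ih M rfl
    exact ⟨m, y, _, fun l => .parR (h2 l)⟩

theorem CanReply.nu {c : ℕ} {Q : Proc} (h : CanReply (c + 1) Q) : CanReply c (.nu Q) := by
  intro M N u A h1
  cases h1 with
  | ext h1 =>
    obtain ⟨m, y, R, h2⟩ := h h1
    refine ⟨m, y, R, fun l => ?_⟩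
    have := h2 l
    simpa only [Nat.add_assoc, Nat.add_comm 1] using this

/-! ### Challenge-response protocols -/

/-- A challenge-response protocol between a verifier and a prover that share keys `e` and `k`, on
the public channels `c` (for outputs) and `d` (for inputs). The fields record the stages of the two
roles, and everything about their transitions that matters to the unlinkability game. The key `k`
identifies the session in which a verifier replies. -/
structure Protocol where
  /-- The number of restricted keys of a session; they are the indices `0` and, if there are two,
  `1`. -/
  keys : ℕ
  keys_pos : 0 < keys
  /-- The verifier that waits for a challenge. -/
  V (c d e k : ℕ) : Proc
  /-- The verifier that has received the challenge `N`. -/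
  VGot (c e k : ℕ) (N : Msg) : Proc
  /-- The prover that has not started. -/
  P (c d e k : ℕ) : Proc
  /-- The prover that has sent its nonce `t` and waits for a reply. -/
  PWait (c d e k t : ℕ) : Proc
  /-- The prover that has received `y` as a reply to its nonce `t`. -/
  PGot (c d e k t : ℕ) (y : Msg) : Proc
  /-- `IsReply e k N y`: the message `y` is a verifier's reply to the challenge `N`. -/
  IsReply (e k : ℕ) (N y : Msg) : Prop
  V_ren (r : ℕ → ℕ) (c d e k : ℕ) : (V c d e k).ren r = V (r c) (r d) (r e) (r k)
  P_ren (r : ℕ → ℕ) (c d e k : ℕ) : (P c d e k).ren r = P (r c) (r d) (r e) (r k)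
  PWait_ren (r : ℕ → ℕ) (c d e k t : ℕ) :
    (PWait c d e k t).ren r = PWait (r c) (r d) (r e) (r k) (r t)
  V_inv {c d e k : ℕ} {π : Act} {u : LocLabel} {A : Ext} : PStep (V c d e k) π u A →
    ∃ M N, π = .inp M N ∧ u = .one ([], []) ∧ A = ⟨0, ASubst.id, VGot c e k N⟩
  V_inp (c d e k : ℕ) (N : Msg) :
    PStep (V c d e k) (.inp (.var d) N) (.one ([], [])) ⟨0, ASubst.id, VGot c e k N⟩
  VGot_inv {c e k : ℕ} {N M : Msg} {a : Alias} {u : LocLabel} {A : Ext} :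
    PStep (VGot c e k N) (.out M a) u A → ∃ m y N',
      A = ⟨m, ASubst.id.extend a y, .nil⟩ ∧ IsReply (e + m) (k + m) N' y
  VGot_out (c e k : ℕ) (N : Msg) : ∃ m y, IsReply (e + m) (k + m) (N.shift m) y ∧
    ∀ l, PStep (VGot c e k N) (.out (.var c) ([], l)) (.one ([], []))
      ⟨m, ASubst.id.extend ([], l) y, .nil⟩
  P_inv {c d e k : ℕ} {π : Act} {u : LocLabel} {A : Ext} : PStep (P c d e k) π u A →
    ∃ M a, π = .out M a ∧
      A = ⟨1, ASubst.id.extend a (.var 0), PWait (c + 1) (d + 1) (e + 1) (k + 1) 0⟩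
  P_out (c d e k l : ℕ) : PStep (P c d e k) (.out (.var c) ([], l)) (.one ([], []))
    ⟨1, ASubst.id.extend ([], l) (.var 0), PWait (c + 1) (d + 1) (e + 1) (k + 1) 0⟩
  PWait_inv {c d e k t : ℕ} {π : Act} {u : LocLabel} {A : Ext} : PStep (PWait c d e k t) π u A →
    ∃ M N, π = .inp M N ∧ A = ⟨0, ASubst.id, PGot c d e k t N⟩
  PWait_inp (c d e k t : ℕ) (N : Msg) :
    PStep (PWait c d e k t) (.inp (.var d) N) (.one ([], [])) ⟨0, ASubst.id, PGot c d e k t N⟩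
  /-- A prover accepts the replies to its own nonce under its own keys. -/
  PGot_out {c d e k t : ℕ} {y : Msg} : IsReply e k (.var t) y → ∃ m z,
    ∀ l, PStep (PGot c d e k t y) (.out (.var c) ([], l)) (.one ([], []))
      ⟨m, ASubst.id.extend ([], l) z, .nil⟩
  /-- A prover does not accept a mere name. -/
  PGot_var {c d e k t i : ℕ} {π : Act} {u : LocLabel} {A : Ext} :
    ¬ PStep (PGot c d e k t (.var i)) π u A
  /-- A prover does not accept a reply under another key. -/
  PGot_of_ne {c d e k t e' k' : ℕ} {N y : Msg} {π : Act} {u : LocLabel} {A : Ext} :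
    IsReply e' k' N y → k' ≠ k → ¬ PStep (PGot c d e k t y) π u A

namespace Protocol

variable (Pr : Protocol)

/-- The two roles of a session that uses the given keys, both unstarted. -/
def roles (c d e k : ℕ) : Proc := .par (Pr.V c d e k) (Pr.P c d e k)

/-- Provers and verifiers may run any number of sessions with the same keys. -/
def system (c d : ℕ) : Proc :=
  .bang (nus Pr.keys (.bang (Pr.roles (c + Pr.keys) (d + Pr.keys) 1 0)))

/-- Every prover and every verifier runs a single session. -/
def spec (c d : ℕ) : Proc :=
  .bang (nus Pr.keys (Pr.roles (c + Pr.keys) (d + Pr.keys) 1 0))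

/-- `y` is a reply of a verifier under a key outside of `F`. -/
def RepliedOutside (F : Set ℕ) (y : Msg) : Prop := ∃ e k N, k ∉ F ∧ Pr.IsReply e k N y

/-- `Quiet c d F Q`: no prover of `Q` waits for a reply, every verifier of `Q` is finished or has
not started, and none of those that have not started uses a key in `F`. -/
inductive Quiet : ℕ → ℕ → Set ℕ → Proc → Prop
  | nil {c d : ℕ} {F : Set ℕ} : Quiet c d F .nil
  | V {c d e k : ℕ} {F : Set ℕ} : k ∉ F → Quiet c d F (Pr.V c d e k)
  | P {c d e k : ℕ} {F : Set ℕ} : Quiet c d F (Pr.P c d e k)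
  | par {c d : ℕ} {F : Set ℕ} {Q Q' : Proc} :
      Quiet c d F Q → Quiet c d F Q' → Quiet c d F (.par Q Q')
  | bang {c d : ℕ} {F : Set ℕ} {Q : Proc} : Quiet c d F Q → Quiet c d F (.bang Q)
  | nu {c d : ℕ} {F : Set ℕ} {Q : Proc} :
      Quiet (c + 1) (d + 1) ((· + 1) '' F) Q → Quiet c d F (.nu Q)

/-- `Around c d F X s Q`: the process `Q` is a parallel composition with the component `X` at the
location `s`, and all its other components are quiet. -/
inductive Around (c d : ℕ) (F : Set ℕ) (X : Proc) : Str → Proc → Prop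
  | here : Around c d F X [] X
  | parL {s : Str} {Q Q' : Proc} :
      Around c d F X s Q → Quiet Pr c d F Q' → Around c d F X (false :: s) (.par Q Q')
  | parR {s : Str} {Q Q' : Proc} :
      Quiet Pr c d F Q → Around c d F X s Q' → Around c d F X (true :: s) (.par Q Q')

variable {Pr}

theorem V_shift (n c d e k : ℕ) :
    (Pr.V c d e k).shift n = Pr.V (c + n) (d + n) (e + n) (k + n) := Pr.V_ren _ c d e k

theorem PWait_shift (n c d e k t : ℕ) : (Pr.PWait c d e k t).shift n =
    Pr.PWait (c + n) (d + n) (e + n) (k + n) (t + n) := Pr.PWait_ren _ c d e k t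

theorem P_shift (n c d e k : ℕ) :
    (Pr.P c d e k).shift n = Pr.P (c + n) (d + n) (e + n) (k + n) := Pr.P_ren _ c d e k

theorem bang_roles_shift (n c d e k : ℕ) : (Proc.bang (Pr.roles c d e k)).shift n =
    .bang (Pr.roles (c + n) (d + n) (e + n) (k + n)) := by
  change Proc.bang (.par ((Pr.V c d e k).shift n) ((Pr.P c d e k).shift n)) = _
  rw [V_shift, P_shift]
  rfl

theorem Quiet.ren {c d : ℕ} {F F' : Set ℕ} {Q : Proc} (h : Quiet Pr c d F Q) {r : ℕ → ℕ}
    (hr : r ⁻¹' F' ⊆ F) : Quiet Pr (r c) (r d) F' (Q.ren r) := by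
  induction h generalizing r F' with
  | nil => exact .nil
  | V hk =>
    rw [V_ren]
    exact .V fun hk' => hk (hr hk')
  | P =>
    rw [P_ren]
    exact .P
  | par _ _ ih ih' => exact .par (ih hr) (ih' hr)
  | bang _ ih => exact .bang (ih hr)
  | nu _ ih =>
    rw [Proc.ren_nu]
    refine .nu (ih (r := liftRen r) ?_)
    rintro (_ | x) ⟨y, hy, hxy⟩
    · simp [liftRen] at hxy
    · simp only [liftRen, Nat.add_right_cancel_iff] at hxy
      exact ⟨x, hr (by rwa [hxy] at hy), rfl⟩

theorem Quiet.shift {c d : ℕ} {F : Set ℕ} {Q : Proc} (h : Quiet Pr c d F Q) (n : ℕ) :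
    Quiet Pr (c + n) (d + n) ((· + n) '' F) (Q.shift n) :=
  h.ren (r := (· + n)) (Set.preimage_image_eq F (add_left_injective n)).subset

theorem Quiet.anti {c d : ℕ} {F F' : Set ℕ} {Q : Proc} (h : Quiet Pr c d F Q) (hF : F' ⊆ F) :
    Quiet Pr c d F' Q := by
  have := h.ren (r := fun x => x) hF
  rwa [Proc.ren_id] at this

theorem Quiet.nus {n c d : ℕ} {F : Set ℕ} {Q : Proc}
    (h : Quiet Pr (c + n) (d + n) ((· + n) '' F) Q) : Quiet Pr c d F (nus n Q) := by
  induction n generalizing c d F with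
  | zero => simpa [APi.nus] using h
  | succ n ih =>
    refine .nu (ih ?_)
    rw [Set.image_image]
    simpa only [Nat.add_assoc, Nat.add_comm 1] using h

theorem zero_notMem_image_keys (F : Set ℕ) : 0 ∉ (· + Pr.keys) '' F := by
  rintro ⟨x, -, hx⟩
  have := Pr.keys_pos
  simp only at hx
  omega

theorem quiet_roles {c d e k : ℕ} {F : Set ℕ} (hk : k ∉ F) :
    Quiet Pr c d F (Pr.roles c d e k) := .par (.V hk) .P

theorem quiet_session (c d : ℕ) (F : Set ℕ) :
    Quiet Pr c d F (APi.nus Pr.keys (Pr.roles (c + Pr.keys) (d + Pr.keys) 1 0)) :=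
  .nus (quiet_roles (zero_notMem_image_keys F))

theorem quiet_spec (c d : ℕ) (F : Set ℕ) : Quiet Pr c d F (Pr.spec c d) :=
  .bang (quiet_session c d F)

theorem quiet_system (c d : ℕ) (F : Set ℕ) : Quiet Pr c d F (Pr.system c d) :=
  .bang (.nus (.bang (quiet_roles (zero_notMem_image_keys F))))

theorem inOut_V (c d e k : ℕ) (N : Msg) : InOut (Pr.V c d e k) N
    fun n y R => R = .nil ∧ ∃ e' N', Pr.IsReply e' (k + n) N' y := by
  intro M u A h1 M' a u' B h2 _
  obtain ⟨M₁, N₁, h, -, rfl⟩ := V_inv _ h1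
  obtain ⟨m, y, N', rfl, hy⟩ := VGot_inv _ h2
  exact ⟨y, rfl, rfl, _, N', by simpa using hy⟩

/-- A quiet process answers every input by the reply of a verifier. -/
theorem Quiet.inOut {c d : ℕ} {F : Set ℕ} {Q : Proc} (h : Quiet Pr c d F Q) (N : Msg) :
    InOut Q N fun n y R => Pr.RepliedOutside ((· + n) '' F) y ∧
      Quiet Pr (c + n) (d + n) ((· + n) '' F) R := by
  induction h generalizing N with
  | nil => exact fun _ _ _ h => nomatch h
  | @V c d e k F hk =>
    refine (inOut_V c d e k N).mono ?_
    rintro n y R ⟨rfl, e', N', hy⟩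
    exact ⟨⟨e', k + n, N', by rwa [(add_left_injective n).mem_set_image], hy⟩, .nil⟩
  | P =>
    intro M u A h1
    obtain ⟨_, _, h, -⟩ := P_inv _ h1
    exact nomatch h
  | par hQ hQ' ih ih' =>
    exact .par ((ih N).mono fun n y R h => ⟨h.1, .par h.2 (hQ'.shift n)⟩)
      ((ih' N).mono fun n y R h => ⟨h.1, .par (hQ.shift n) h.2⟩)
  | bang hQ ih =>
    exact .bang ((ih N).mono fun n y R h => ⟨h.1, .par h.2 (hQ.bang.shift n)⟩)
      fun n y R h => ⟨h.1, .par (hQ.shift n) h.2⟩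
  | nu hQ ih =>
    refine .nu ((ih _).mono fun n y R h => ?_)
    simpa only [Set.image_image, Nat.add_assoc, Nat.add_comm 1] using h

theorem Quiet.canReply {c d : ℕ} {F : Set ℕ} {Q : Proc} (h : Quiet Pr c d F Q) :
    CanReply c Q := by
  induction h with
  | nil => exact fun _ _ _ _ h => nomatch h
  | @V c d e k F hk =>
    intro M N u A h1
    obtain ⟨_, N', -, rfl, rfl⟩ := V_inv _ h1
    obtain ⟨m, y, -, h2⟩ := Pr.VGot_out c e k N'
    exact ⟨m, y, _, h2⟩
  | P =>
    intro M N u A h1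
    obtain ⟨_, _, h, -⟩ := P_inv _ h1
    exact nomatch h
  | par _ _ ih ih' => exact .par ih ih'
  | bang _ ih => exact .bang ih
  | nu _ ih => exact .nu ih

theorem Around.quiet {c d : ℕ} {F : Set ℕ} {X Q : Proc} {s : Str}
    (h : Around Pr c d F X s Q) (hX : Quiet Pr c d F X) : Quiet Pr c d F Q := by
  induction h with
  | here => exact hX
  | parL _ hq ih => exact .par ih hq
  | parR hq _ ih => exact .par hq ih

theorem Around.anti {c d : ℕ} {F F' : Set ℕ} {X Q : Proc} {s : Str}
    (h : Around Pr c d F X s Q) (hF : F' ⊆ F) : Around Pr c d F' X s Q := by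
  induction h with
  | here => exact .here
  | parL _ hq ih => exact .parL ih (hq.anti hF)
  | parR hq _ ih => exact .parR (hq.anti hF) ih

theorem Around.trans {c d : ℕ} {F : Set ℕ} {X Y Q : Proc} {s t : Str}
    (h : Around Pr c d F Y s Q) (h' : Around Pr c d F X t Y) : Around Pr c d F X (s ++ t) Q := by
  induction h with
  | here => exact h'
  | parL _ hq ih => exact .parL ih hq
  | parR hq _ ih => exact .parR hq ih

theorem Around.shift {c d : ℕ} {F : Set ℕ} {X Q : Proc} {s : Str}
    (h : Around Pr c d F X s Q) (n : ℕ) :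
    Around Pr (c + n) (d + n) ((· + n) '' F) (X.shift n) s (Q.shift n) := by
  induction h with
  | here => exact .here
  | parL _ hq ih => exact .parL ih (hq.shift n)
  | parR hq _ ih => exact .parR (hq.shift n) ih

/-- An input that a distinguished component does not answer itself is answered by the reply of a
verifier elsewhere. -/
theorem Around.inOut {c d : ℕ} {F : Set ℕ} {X Q : Proc} {s : Str}
    (h : Around Pr c d F X s Q) {N : Msg} {Post : ℕ → Msg → Proc → Prop} (hX : InOut X N Post) :
    InOut Q N fun n y R =>
      (∃ X', Post n y X' ∧ Around Pr (c + n) (d + n) ((· + n) '' F) X' s R) ∨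
      (Pr.RepliedOutside ((· + n) '' F) y ∧
        Around Pr (c + n) (d + n) ((· + n) '' F) (X.shift n) s R) := by
  induction h with
  | here => exact hX.mono fun n y R h => Or.inl ⟨R, h, .here⟩
  | parL hQ hq ih =>
    refine .par (ih.mono fun n y R h => ?_) ((hq.inOut N).mono fun n y R h => ?_)
    · exact h.imp (fun ⟨X', h1, h2⟩ => ⟨X', h1, .parL h2 (hq.shift n)⟩)
        fun h => ⟨h.1, .parL h.2 (hq.shift n)⟩
    · exact Or.inr ⟨h.1, .parL (hQ.shift n) h.2⟩
  | parR hq hQ ih =>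
    refine .par ((hq.inOut N).mono fun n y R h => ?_) (ih.mono fun n y R h => ?_)
    · exact Or.inr ⟨h.1, .parR h.2 (hQ.shift n)⟩
    · exact h.imp (fun ⟨X', h1, h2⟩ => ⟨X', h1, .parR (hq.shift n) h2⟩)
        fun h => ⟨h.1, .parR (hq.shift n) h.2⟩

/-- The moves of a component are moves of the whole. -/
theorem Around.step {c d : ℕ} {F : Set ℕ} {X Q : Proc} {s : Str} (h : Around Pr c d F X s Q)
    (n : ℕ) (X' : Proc) : ∃ R, Around Pr (c + n) (d + n) ((· + n) '' F) X' s R ∧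
      ∀ {π σ}, PStep X π (.one ([], [])) ⟨n, σ, X'⟩ → PStep Q π (.one (s, [])) ⟨n, σ, R⟩ := by
  induction h with
  | here => exact ⟨X', .here, fun h => h⟩
  | parL hQ hq ih =>
    obtain ⟨R, h1, h2⟩ := ih
    exact ⟨_, .parL h1 (hq.shift n), fun h => .parL (h2 h)⟩
  | parR hq hQ ih =>
    obtain ⟨R, h1, h2⟩ := ih
    exact ⟨_, .parR (hq.shift n) h1, fun h => .parR (h2 h)⟩

/-- Only the component at `s` makes outputs that depend structurally on `s`. -/
theorem Around.out_inv {c d : ℕ} {F : Set ℕ} {X Q : Proc} {s t : Str}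
    (h : Around Pr c d F X s Q) {M : Msg} {a : Alias} {u : LocLabel} {A : Ext}
    (hA : PStep Q (.out M a) u A) (hu : ¬ LocIndep u (.one (s, t))) :
    ∃ u' A', PStep X (.out M a) u' A' := by
  induction h generalizing u A with
  | here => exact ⟨u, A, hA⟩
  | @parL s _ _ hQ hq ih =>
    cases hA with
    | parL hA => exact ih hA fun hi => hu (hi.cons false)
    | parR hA =>
      obtain ⟨-, -, l, rfl⟩ := hA.sub_of_out _ _ rfl
      exact absurd (LocIndep.cons_ne (l' := (s, t)) (by simp)) hu
  | @parR s _ _ hq hQ ih =>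
    cases hA with
    | parR hA => exact ih hA fun hi => hu (hi.cons true)
    | parL hA =>
      obtain ⟨-, -, l, rfl⟩ := hA.sub_of_out _ _ rfl
      exact absurd (LocIndep.cons_ne (l' := (s, t)) (by simp)) hu

/-! ### A waiting prover -/

/-- A waiting prover that is offered a message which it does not accept stays waiting, and the
input can only be answered by a verifier elsewhere. -/
theorem inOut_PWait_of_reject {c d e k t : ℕ} {F : Set ℕ} {Q : Proc} {s : Str} {N : Msg}
    (h : Around Pr c d F (Pr.PWait c d e k t) s Q)
    (hN : ∀ ⦃M a u A⦄, ¬ PStep (Pr.PGot c d e k t N) (.out M a) u A) :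
    InOut Q N fun n y R => Pr.RepliedOutside ((· + n) '' F) y ∧
      Around Pr (c + n) (d + n) ((· + n) '' F)
        (Pr.PWait (c + n) (d + n) (e + n) (k + n) (t + n)) s R := by
  have hX : InOut (Pr.PWait c d e k t) N fun _ _ _ => False := by
    intro M u A h1 M' a u' B h2 _
    obtain ⟨M₁, N₁, h, rfl⟩ := PWait_inv _ h1
    cases h
    exact absurd h2 (@hN _ _ _ _)
  refine (h.inOut hX).mono fun n y R h => ?_
  rw [Proc.shift_eq_ren, PWait_ren] at h
  simpa using h

/-- As long as the verifier with the key `k` of a waiting prover has not replied, either it replies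
to an input that the prover does not accept, or a verifier with another key does. -/
theorem inOut_roles_of_reject {c d e k t : ℕ} {Q : Proc} {s : Str} {N : Msg}
    (h : Around Pr c d {k} (.par (Pr.V c d e k) (Pr.PWait c d e k t)) s Q)
    (hN : ∀ ⦃M a u A⦄, ¬ PStep (Pr.PGot c d e k t N) (.out M a) u A) :
    InOut Q N fun n y R =>
      (Pr.RepliedOutside {k + n} y ∧ ∃ s, Around Pr (c + n) (d + n) ∅
        (Pr.PWait (c + n) (d + n) (e + n) (k + n) (t + n)) s R) ∨
      ∃ s, Around Pr (c + n) (d + n) {k + n}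
        (Pr.PWait (c + n) (d + n) (e + n) (k + n) (t + n)) s R := by
  have hX : InOut (.par (Pr.V c d e k) (Pr.PWait c d e k t)) N fun n _ R =>
      R = .par .nil (Pr.PWait (c + n) (d + n) (e + n) (k + n) (t + n)) := by
    refine .par ((inOut_V c d e k N).mono ?_) ?_
    · rintro n y R ⟨rfl, -⟩
      rw [Proc.shift_eq_ren, PWait_ren]
    · intro M u A h1 M' a u' B h2 _
      obtain ⟨M₁, N₁, h, rfl⟩ := PWait_inv _ h1
      cases h
      exact absurd h2 (@hN _ _ _ _)
  refine (h.inOut hX).mono fun n y R h => ?_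
  rw [Set.image_singleton] at h
  rcases h with ⟨X', rfl, h⟩ | ⟨hy, h⟩
  · exact Or.inr ⟨_, h.trans (.parR .nil .here)⟩
  · have hs : (Proc.par (Pr.V c d e k) (Pr.PWait c d e k t)).shift n =
        .par ((Pr.V c d e k).shift n) ((Pr.PWait c d e k t).shift n) := rfl
    rw [hs, V_shift, PWait_shift] at h
    exact Or.inl ⟨hy, _, (h.anti (Set.empty_subset _)).trans (.parR (.V (by simp)) .here)⟩

/-- The specification starts by the output of a prover, whose session is the only one that has
started. -/
theorem spec_out_inv {c d : ℕ} {M : Msg} {a : Alias} {u : LocLabel} {A : Ext}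
    (h : PStep (Pr.spec c d) (.out M a) u A) : ∃ i e k t s,
      A.sub = ASubst.id.extend a (.var i) ∧
      Around Pr (c + A.binders) (d + A.binders) {k}
        (.par (Pr.V (c + A.binders) (d + A.binders) e k)
          (Pr.PWait (c + A.binders) (d + A.binders) e k t)) s A.proc := by
  refine PStep.bang_induction (Φ := fun π u A => ∀ M, π = .out M a → ∃ i e k t s,
      A.sub = ASubst.id.extend a (.var i) ∧
      Around Pr (c + A.binders) (d + A.binders) {k}
        (.par (Pr.V (c + A.binders) (d + A.binders) e k)
          (Pr.PWait (c + A.binders) (d + A.binders) e k t)) s A.proc)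
    ?_ ?_ h (by simp) M rfl
  · rintro π u n σ R h M rfl
    obtain ⟨m, hm, h⟩ := h.nus_inv
    cases h with
    | parL h =>
      obtain ⟨_, _, h, -⟩ := V_inv _ h
      exact nomatch h
    | parR h =>
      obtain ⟨_, _, h, hA⟩ := P_inv _ h
      cases h
      cases hA
      simp only at hm
      subst hm
      rw [V_shift]
      simp only [Nat.add_assoc, Nat.add_comm Pr.keys]
      exact ⟨_, _, _, _, _, rfl, .parL .here ((quiet_spec c d _).ren (r := (· + _)) subset_rfl)⟩
  · rintro π u n σ R h ih M rfl
    obtain ⟨i, e, k, t, s, h1, h2⟩ := ih M rfl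
    exact ⟨i, e, k, t, _, h1, .parR ((quiet_session c d _).ren (r := (· + _)) subset_rfl) h2⟩

end Protocol

/-! ### Moves of the bisimulation game -/

theorem Msg.ren_als {ρ : AliasBij} {a b : Alias} (h : ρ a = some b) :
    (Msg.als a).ren ρ = .als b := by
  simp [Msg.ren, Msg.substAls, h]

theorem AliasBij.update_same (ρ : AliasBij) (a b : Alias) : ρ.update a b a = some b := by
  change (if a = a then some b else _) = some b
  simp

theorem AliasBij.update_of_ne {ρ : AliasBij} {a b x y : Alias} (h : ρ x = some y) (hx : x ≠ a)
    (hy : y ≠ b) : ρ.update a b x = some y := by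
  change (if x = a then some b else if ρ x = some b then none else ρ x) = some y
  simp [hx, h, hy]

theorem EvRel.union_sep (S : EvRel) (p : Event × Event → Prop) :
    {x ∈ S | p x} ∪ {x ∈ S | ¬ p x} = S := by
  ext x
  by_cases h : p x <;> simp [h]

/-- An answer to an input. The pair of the two events is recorded. -/
theorem IsHPSimulation.answer_inp {R : HPRel} (hR : IsHPSimulation R) {A A' B : Ext}
    {ρ : AliasBij} {S : EvRel} (h : R A ρ S B) {M N : Msg} {u : LocLabel}
    (hA : Step A (.inp M N) u A') :
    ∃ B' u' S', Step B (.inp (M.ren ρ) (N.ren ρ)) u' B' ∧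
      ((.inp M N, u), (.inp (M.ren ρ) (N.ren ρ), u')) ∈ S' ∧ R A' ρ S' B' := by
  rw [← EvRel.union_sep S fun p => Indep (.inp M N, u) p.1] at h
  obtain ⟨B', u', h1, -, -, h2⟩ := hR.free h hA (by simp [Act.IsOut])
    (by rintro _ ⟨p, hp, rfl⟩; exact hp.2) (by rintro _ ⟨p, hp, rfl⟩; exact hp.2)
  exact ⟨B', u', _, h1, Or.inr rfl, h2⟩

/-- An answer to an output depends on the recorded events in the same way as the output does. -/
theorem IsHPSimulation.answer_out {R : HPRel} (hR : IsHPSimulation R) {A A' B : Ext}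
    {ρ : AliasBij} {S : EvRel} (h : R A ρ S B) {M : Msg} {a : Alias} {u : LocLabel}
    (hA : Step A (.out M a) u A') :
    ∃ B' u' a' S', Step B (.out (M.ren ρ) a') u' B' ∧
      (∀ p ∈ S, ¬ Indep (.out M a, u) p.1 → ¬ Indep (.out (M.ren ρ) a', u') p.2) ∧
      R A' (ρ.update a a') S' B' := by
  rw [← EvRel.union_sep S fun p => Indep (.out M a, u) p.1] at h
  obtain ⟨B', u', a', h1, -, h2, h3⟩ := hR.out h hA
    (by rintro _ ⟨p, hp, rfl⟩; exact hp.2) (by rintro _ ⟨p, hp, rfl⟩; exact hp.2)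
  exact ⟨B', u', a', _, h1, fun p hp hi => h2 _ ⟨p, ⟨hp, hi⟩, rfl⟩, h3⟩

/-- An input that is followed by an output at the same place is answered by such a pair. -/
theorem IsHPSimulation.answer_inp_out {R : HPRel} (hR : IsHPSimulation R) {A A₁ A₂ B : Ext}
    {ρ : AliasBij} {S : EvRel} (h : R A ρ S B) {M N M' : Msg} {a : Alias} {u v : LocLabel}
    (hA : Step A (.inp M N) u A₁) (hA₁ : Step A₁ (.out M' a) v A₂) (hu : ¬ LocIndep v u) :
    ∃ B₁ B₂ u' v' a' S', Step B (.inp (M.ren ρ) (N.ren ρ)) u' B₁ ∧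
      Step B₁ (.out (M'.ren ρ) a') v' B₂ ∧ ¬ LocIndep v' u' ∧ R A₂ (ρ.update a a') S' B₂ := by
  obtain ⟨B₁, u', S₁, h1, hS, h2⟩ := hR.answer_inp h hA
  obtain ⟨B₂, v', a', S₂, h3, h4, h5⟩ := hR.answer_out h2 hA₁
  refine ⟨B₁, B₂, u', v', a', S₂, h1, h3, fun hi => ?_, h5⟩
  -- the output does not depend on the input by its link, since its alias is fresh
  obtain ⟨_, _, -, hM, hN, rfl⟩ := h1.inp_inv _ _ rfl
  obtain ⟨_, _, _, -, ha', -⟩ := h3.out_inv _ _ rfl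
  rw [Ext.dom, ASubst.dom_shift] at ha'
  refine h4 _ hS (fun hi' => hu hi'.1) ⟨hi, ?_, trivial⟩
  rintro (ha | ha)
  · exact ha' (hM ha)
  · exact ha' (hN ha)

/-- One exchange of the game: on the left, a component at `s` inputs the message behind the alias
`b` and outputs at the same place; the right-hand side answers as `Post` prescribes. -/
theorem IsHPSimulation.exchange {R : HPRel} (hR : IsHPSimulation R) {c d n m : ℕ} {σ : ASubst}
    {Q Q₁ Q₂ : Proc} {B : Ext} {ρ : AliasBij} {S : EvRel} {b b' : Alias} {s : Str}
    {N N' y : Msg} {Post : ℕ → Msg → Proc → Prop}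
    (h : R ⟨n, σ, Q⟩ ρ S B) (hσ : σ.dom.Finite) (hb : σ b = some N) (hρ : ρ b = some b')
    (hb' : B.sub b' = some N')
    (h₁ : PStep Q (.inp (.var (d + n)) N) (.one (s, [])) ⟨0, ASubst.id, Q₁⟩)
    (h₂ : ∀ l, PStep Q₁ (.out (.var (c + n)) ([], l)) (.one (s, []))
      ⟨m, ASubst.id.extend ([], l) y, Q₂⟩)
    (hB : InOut B.proc N' Post) :
    ∃ a ρ' S' m' a' y' B₂, R ⟨m + n, (σ.shift m).extend a y, Q₂⟩ ρ' S'
        ⟨m' + B.binders, (B.sub.shift m').extend a' y', B₂⟩ ∧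
      a ∉ σ.dom ∧ a' ∉ B.dom ∧ Post m' y' B₂ ∧ ρ' a = some a' ∧
      ∀ x x', ρ x = some x' → ρ' x = some x' := by
  obtain ⟨l, hl⟩ : ∃ l, (s, l) ∉ σ.dom := by
    by_contra! hall
    exact Set.infinite_of_injective_forall_mem (f := fun l : ℕ => (s, l))
      (fun _ _ hxy => (Prod.mk.inj hxy).2) hall hσ
  have hA : Step ⟨n, σ, Q⟩ (.inp (.var d) (.als b)) (.one (s, [])) ⟨n, σ, Q₁⟩ := by
    have := Step.of_inp (n := n) (σ := σ) (M := .var d) (N := .als b) (m := 0) (R := Q₁)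
      (P := Q) (u := .one (s, [])) (by rw [Msg.shift_als, Msg.app_als hb]; exact h₁)
      (Set.empty_subset _) (by rintro _ rfl; simp [ASubst.dom, hb])
    rwa [Nat.zero_add, ASubst.shift_zero] at this
  have hA₁ := Step.of_out (n := n) (σ := σ) (M := .var c) (h₂ l) (Set.empty_subset _) hl
  obtain ⟨B₁, B₂, u', v', a', S', hB₁, hB₂, hi, hR'⟩ :=
    hR.answer_inp_out h hA hA₁ (LocIndep.irrefl _)
  rw [Msg.ren_als hρ] at hB₁
  obtain ⟨k, R₁, h3, -, -, rfl⟩ := hB₁.inp_inv _ _ rfl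
  obtain ⟨k', z, R₂, h4, ha', rfl⟩ := hB₂.out_inv _ _ rfl
  rw [Ext.dom, ASubst.dom_shift] at ha'
  rw [Msg.shift_als, Msg.app_als hb'] at h3
  obtain ⟨y', hy, hpost⟩ := hB h3 h4 hi
  cases ASubst.extend_inj hy
  simp only [ASubst.shift_shift, ← Nat.add_assoc, Nat.add_comm k' k] at hR'
  refine ⟨_, _, S', k + k', a', z, R₂, hR', hl, ha', hpost, AliasBij.update_same _ _ _, ?_⟩
  intro x x' hx
  have hbij := hR.bij h
  refine AliasBij.update_of_ne hx ?_ ?_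
  · rintro rfl
    exact hl ((hbij.1 _).2 (by simp [hx]))
  · rintro rfl
    exact ha' ((hbij.2 _).2 (by simp [ρ.eq_some_iff.2 hx]))

namespace Protocol

variable {Pr : Protocol}

/-- The part of the game in which the left-hand side completes the session of its waiting prover by
a reply that is under a wrong key on the right-hand side. Then a prover waits on the right-hand side
only. It consumes any input without an output after that, whereas on the left-hand side every input
is by a verifier, which outputs next. -/
theorem not_bisimilar_of_reply {R : HPRel} (hR : IsHPSimulation R) (hsym : R.IsSymmetric)
    {c d n n' e k t e' k' t' : ℕ} {σ σ' : ASubst} {Q Q' : Proc} {ρ : AliasBij} {S : EvRel}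
    {b b' : Alias} {s s' : Str} {y y' : Msg}
    (h : R ⟨n, σ, Q⟩ ρ S ⟨n', σ', Q'⟩) (hσ : σ.dom.Finite)
    (hQ : Around Pr (c + n) (d + n) ∅ (Pr.PWait (c + n) (d + n) e k t) s Q)
    (hQ' : Around Pr (c + n') (d + n') ∅ (Pr.PWait (c + n') (d + n') e' k' t') s' Q')
    (hb : σ b = some y) (hρ : ρ b = some b') (hb' : σ' b' = some y')
    (hy : Pr.IsReply e k (.var t) y) (hy' : Pr.RepliedOutside {k'} y') : False := by
  have hrej : ∀ ⦃M a u A⦄, ¬ PStep (Pr.PGot (c + n') (d + n') e' k' t' y') (.out M a) u A := by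
    obtain ⟨_, _, _, hk, hy'⟩ := hy'
    exact fun _ _ _ _ => PGot_of_ne _ hy' hk
  -- the prover on the left accepts `y`, after which no prover waits on the left
  obtain ⟨Q₁, hQ₁, h₁⟩ := hQ.step 0 (Pr.PGot (c + n) (d + n) e k t y)
  obtain ⟨m, z, h₂⟩ := Pr.PGot_out (c := c + n) (d := d + n) hy
  obtain ⟨Q₂, hQ₂, h₂'⟩ := hQ₁.step m .nil
  have hQ₂ := hQ₂.quiet .nil
  obtain ⟨a, ρ₂, S₂, m', a', z', B₂, h, -, -, ⟨-, hB₂⟩, -, -⟩ :=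
    hR.exchange h hσ hb hρ hb' (h₁ (Pr.PWait_inp _ _ _ _ _ _)) (fun l => h₂' (h₂ l))
      (inOut_PWait_of_reject hQ' hrej)
  -- on the right, the prover that still waits consumes a name
  obtain ⟨B₃, hB₃, h₃⟩ := hB₂.step 0 (Pr.PGot (c + n' + m') (d + n' + m') (e' + m')
    (k' + m') (t' + m') (.var (0 + (m' + n'))))
  have hstep : Step ⟨m' + n', (σ'.shift m').extend a' z', B₂⟩ (.inp (.var d) (.var 0))
      (.one (s', [])) ⟨0 + (m' + n'), ((σ'.shift m').extend a' z').shift 0, B₃⟩ := by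
    refine Step.of_inp ?_ (Set.empty_subset _) (Set.empty_subset _)
    have := h₃ (Pr.PWait_inp (c + n' + m') (d + n' + m') (e' + m') (k' + m') (t' + m')
      (.var (0 + (m' + n'))))
    rwa [Nat.add_assoc, Nat.add_comm n'] at this
  obtain ⟨A₃, u, S₃, hA₃, hS, h⟩ := hR.answer_inp ((hsym _ _ _ _).1 h) hstep
  -- on the left, a verifier has consumed it, and it replies
  obtain ⟨j, A₃', hA, -, -, rfl⟩ := hA₃.inp_inv _ _ rfl
  obtain ⟨-, ⟨r, r'⟩, rfl⟩ := hA.sub_of_inp _ _ rfl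
  obtain ⟨i, w, A₄, hout⟩ := hQ₂.canReply hA
  have hfin := ASubst.dom_extend_shift_finite hσ m a z
  obtain ⟨l, hl⟩ : ∃ l, (r, l) ∉ (((σ.shift m).extend a z).shift j).dom := by
    rw [ASubst.dom_shift]
    by_contra! hall
    exact Set.infinite_of_injective_forall_mem (f := fun l : ℕ => (r, l))
      (fun _ _ hxy => (Prod.mk.inj hxy).2) hall hfin
  have hstep' := Step.of_out (n := j + (m + n)) (σ := ((σ.shift m).extend a z).shift j)
    (M := .var c) (by
      have := hout l
      simp only [Nat.add_assoc] at this
      rw [show n + (0 + (m + j)) = j + (m + n) by omega] at this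
      exact this) (Set.empty_subset _) hl
  obtain ⟨B₄, v, a₄, S₄, hB₄, hdep, -⟩ := hR.answer_out ((hsym _ _ _ _).1 h) hstep'
  have hdep := hdep _ ⟨_, hS, rfl⟩ (fun hi => LocIndep.irrefl _ hi.1)
  obtain ⟨_, _, _, hB₄, -⟩ := hB₄.out_inv _ _ rfl
  -- this reply cannot be matched at the place of the prover
  obtain ⟨_, _, hfalse⟩ := hB₃.out_inv (t := []) hB₄ fun hi =>
    hdep ⟨hi, by simp [Act.OutFresh, Act.fal, Msg.fal], trivial⟩
  exact Pr.PGot_var hfalse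

/-- A run of the system starts with the nonce of a prover, whose keys are then shared by a verifier
and by all sessions of a replication. -/
theorem system_out (c d : ℕ) : ∃ n e k t Z, Quiet Pr (c + n) (d + n) ∅ Z ∧
    ∀ l, PStep (Pr.system c d) (.out (.var c) ([], l)) (.one ([false, false, true], []))
      ⟨n, ASubst.id.extend ([], l) (.var t),
        .par (.par (.par (Pr.V (c + n) (d + n) e k) (Pr.PWait (c + n) (d + n) e k t))
          (.bang (Pr.roles (c + n) (d + n) e k))) Z⟩ := by
  refine ⟨1 + Pr.keys, 2, 1, 0, (Pr.system c d).shift (1 + Pr.keys),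
    by simpa using (quiet_system (Pr := Pr) c d ∅).shift (1 + Pr.keys), fun l => ?_⟩
  refine .bang (.parL (u := .one ([false, true], [])) (.nus (.bang ?_)))
  have h := PStep.parL (u := .one ([true], []))
    (Q := .bang (Pr.roles (c + Pr.keys) (d + Pr.keys) 1 0))
    (.parR (u := .one ([], [])) (P := Pr.V (c + Pr.keys) (d + Pr.keys) 1 0)
      (Pr.P_out (c + Pr.keys) (d + Pr.keys) 1 0 l))
  rw [V_shift, bang_roles_shift] at h
  simp only [Nat.add_assoc, Nat.add_comm 1] at h ⊢
  exact h

/-- The verifier in the session of the waiting prover replies. -/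
theorem first_reply (c d e k t : ℕ) (W Z : Proc) (N : Msg) : ∃ s Q₁ m y,
    Pr.IsReply (e + m) (k + m) (N.shift m) y ∧
    PStep (.par (.par (.par (Pr.V c d e k) (Pr.PWait c d e k t)) W) Z) (.inp (.var d) N)
      (.one (s, [])) ⟨0, ASubst.id, Q₁⟩ ∧
    ∀ l, PStep Q₁ (.out (.var c) ([], l)) (.one (s, [])) ⟨m, ASubst.id.extend ([], l) y,
      .par (.par (.par .nil (Pr.PWait (c + m) (d + m) (e + m) (k + m) (t + m))) (W.shift m))
        (Z.shift m)⟩ := by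
  obtain ⟨m, y, hy, h⟩ := Pr.VGot_out c e k N
  refine ⟨[false, false, false], _, m, y, hy,
    .parL (u := .one ([false, false], [])) (.parL (u := .one ([false], []))
      (.parL (u := .one ([], [])) (Pr.V_inp c d e k N))), fun l => ?_⟩
  simp only [Proc.shift_zero]
  rw [← PWait_shift]
  exact .parL (u := .one ([false, false], [])) (.parL (u := .one ([false], []))
    (.parL (u := .one ([], [])) (h l)))

/-- A verifier of another session with the same keys replies. -/
theorem second_reply (c d e k : ℕ) (T Z : Proc) (N : Msg) : ∃ s Q₁ m y,
    Pr.IsReply (e + m) (k + m) (N.shift m) y ∧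
    PStep (.par (.par T (.bang (Pr.roles c d e k))) Z) (.inp (.var d) N)
      (.one (s, [])) ⟨0, ASubst.id, Q₁⟩ ∧
    ∀ l, PStep Q₁ (.out (.var c) ([], l)) (.one (s, [])) ⟨m, ASubst.id.extend ([], l) y,
      .par (.par (T.shift m) (.par (.par .nil ((Pr.P c d e k).shift m))
        ((Proc.bang (Pr.roles c d e k)).shift m))) (Z.shift m)⟩ := by
  obtain ⟨m, y, hy, h⟩ := Pr.VGot_out c e k N
  refine ⟨[false, true, false, false], _, m, y, hy,
    .parL (u := .one ([true, false, false], [])) (.parR (u := .one ([false, false], [])) (.bang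
      (.parL (u := .one ([false], [])) (.parL (u := .one ([], [])) (Pr.V_inp c d e k N))))),
    fun l => ?_⟩
  simp only [Proc.shift_zero]
  exact .parL (u := .one ([true, false, false], [])) (.parR (u := .one ([false, false], []))
    (.parL (u := .one ([false], [])) (.parL (u := .one ([], [])) (h l))))

/-- In the system, two verifiers may reply to the nonce of the same prover. In the specification, at
most one of the two replies is under the key of the prover whose nonce it answers. -/
theorem not_bisimilar (Pr : Protocol) (c d : ℕ) :
    ¬ HPBisimilar (Ext.ofProc (Pr.system c d)) (Ext.ofProc (Pr.spec c d)) := by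
  rintro ⟨R, hR, hsym, h⟩
  replace ⟨ρ, h⟩ : ∃ ρ, R (Ext.ofProc (Pr.system c d)) ρ ∅ (Ext.ofProc (Pr.spec c d)) := ⟨_, h⟩
  -- the nonce of a prover is sent, and is found behind the alias `a`
  obtain ⟨n, e, k, t, Z, hZ, hout⟩ := Pr.system_out c d
  have hA := Step.of_out (n := 0) (σ := ASubst.id) (M := .var c) (hout 0) (Set.empty_subset _)
    (by simp [ASubst.dom, ASubst.id])
  obtain ⟨B, u, a', S, hB, -, h⟩ := hR.answer_out h hA
  obtain ⟨n', z, Q', hQ', -, rfl⟩ := hB.out_inv _ _ rfl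
  obtain ⟨i, e', k', t', s', hz, hQ'⟩ := spec_out_inv hQ'
  cases ASubst.extend_inj hz
  have hσ := ASubst.dom_extend_shift_finite (σ := ASubst.id)
    (by simp [ASubst.dom, ASubst.id]) n (([false, false, true], 0) : Alias) (.var t)
  have ha := ASubst.extend_same (ASubst.id.shift n) ([false, false, true], 0) (.var t)
  have ha' := ASubst.extend_same (ASubst.id.shift n') a' (.var i)
  have hρ := AliasBij.update_same ρ ([false, false, true], 0) a'
  replace h : R ⟨n, (ASubst.id.shift n).extend ([false, false, true], 0) (.var t), _⟩ _ S
    ⟨n', (ASubst.id.shift n').extend a' (.var i), Q'⟩ := h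
  -- from here on, only the values behind the aliases and the finiteness of the domain matter
  generalize (ASubst.id.shift n).extend ([false, false, true], 0) (.var t) = σ at h hσ ha
  generalize (ASubst.id.shift n').extend a' (.var i) = σ' at h ha'
  generalize (([false, false, true], 0) : Alias) = a at h ha hρ
  generalize ρ.update a a' = ρ at h hρ
  -- the first reply
  obtain ⟨s, Q₁, m, y, hy, h₁, h₂⟩ := first_reply (Pr := Pr) (c + n) (d + n) e k t
    (.bang (Pr.roles (c + n) (d + n) e k)) Z (.var t)
  obtain ⟨b, ρ, S, m', b', y', Q', h, hb, hb', hpost, hρb, hρ'⟩ := hR.exchange h hσ ha hρ ha' h₁ h₂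
    (inOut_roles_of_reject hQ' fun _ _ _ _ => Pr.PGot_var)
  have hσb := ASubst.extend_same (σ.shift m) b y
  have hσb' := ASubst.extend_same (σ'.shift m') b' y'
  have hσa := ASubst.extend_shift_of_eq y m ha hb
  have hσa' := ASubst.extend_shift_of_eq y' m' ha' hb'
  have hσ := ASubst.dom_extend_shift_finite hσ m b y
  rw [bang_roles_shift] at h
  simp only [Nat.add_assoc, Nat.add_comm n m, Nat.add_comm n' m'] at h hpost
  have hZ : Quiet Pr (c + (m + n)) (d + (m + n)) ∅ (Z.shift m) := by
    simpa [Nat.add_assoc, Nat.add_comm n m] using hZ.shift m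
  rcases hpost with ⟨hy', s₁, hQ'⟩ | ⟨s₁, hQ'⟩
  · exact not_bisimilar_of_reply hR hsym h hσ
      (.parL (.parL (.parR .nil .here) (.bang (quiet_roles (Set.notMem_empty _)))) hZ) hQ' hσb hρb
      hσb' hy hy'
  -- the first reply was under the key of the prover, hence the second one is not
  obtain ⟨s, Q₁, j, x, hx, h₁, h₂⟩ := second_reply (Pr := Pr) (c + (m + n)) (d + (m + n)) (e + m)
    (k + m) _ (Z.shift m) (.var (t + m))
  obtain ⟨f, ρ, S, j', f', x', Q', h, hf, hf', hpost, hρf, -⟩ := hR.exchange h hσ hσa (hρ' _ _ hρ)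
    hσa' h₁ h₂ (inOut_PWait_of_reject hQ' fun _ _ _ _ => Pr.PGot_var)
  have hσf := ASubst.extend_same (((σ.shift m).extend b y).shift j) f x
  have hσf' := ASubst.extend_same (((σ'.shift m').extend b' y').shift j') f' x'
  have hQ : Around Pr (c + (m + n)) (d + (m + n)) ∅
      (Pr.PWait (c + (m + n)) (d + (m + n)) (e + m) (k + m) (t + m)) [true]
      (.par .nil (Pr.PWait (c + (m + n)) (d + (m + n)) (e + m) (k + m) (t + m))) :=
    .parR .nil .here
  have hP : Quiet Pr (c + (m + n)) (d + (m + n)) ∅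
      (Pr.P (c + (m + n)) (d + (m + n)) (e + m) (k + m)) := .P
  have hbang : Quiet Pr (c + (m + n)) (d + (m + n)) ∅
      (.bang (Pr.roles (c + (m + n)) (d + (m + n)) (e + m) (k + m))) :=
    .bang (quiet_roles (Set.notMem_empty _))
  have hQ := Around.parL (.parL (hQ.shift j) (.par (.par .nil (hP.shift j)) (hbang.shift j)))
    (hZ.shift j)
  have hQ' := hpost.2.anti (Set.empty_subset _)
  have hx' := hpost.1
  rw [PWait_shift] at hQ
  simp only [Set.image_empty, Set.image_singleton, Nat.add_assoc c, Nat.add_assoc d,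
    Nat.add_comm (m + n) j, Nat.add_comm (m' + n') j'] at hQ hQ' hx'
  exact not_bisimilar_of_reply hR hsym h (ASubst.dom_extend_shift_finite hσ j f x)
    hQ hQ' hσf hρf hσf' hx hx'

end Protocol

/-! ### The two protocols -/

/-- The BAC protocol. A reply under the keys `e`, `k` is an encryption with `e`, authenticated with
`k`. -/
def bac : Protocol where
  keys := 2
  keys_pos := by simp
  V := verifier
  VGot c e k N := (Proc.nu <| .nu <|
    let m : Msg := .enc (.pair (.var 1) (.pair (.var 2) (.var 0))) (.var (e + 3))
    .out (.var (c + 3)) (.pair m (.mac m (.var (k + 3)))) .nil).subst (instSubst N)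
  P := prover
  PWait c d e k t := .inp (.var d) <|
    .mat (.snd (.var 0)) (.mac (.fst (.var 0)) (.var (k + 1))) <|
    .mat (.var (t + 1)) (.fst (.snd (.dec (.fst (.var 0)) (.var (e + 1))))) <|
    .nu <|
    let m : Msg :=
      .enc (.pair (.var (t + 2)) (.pair (.fst (.dec (.fst (.var 1)) (.var (e + 2)))) (.var 0)))
        (.var (e + 2))
    .out (.var (c + 2)) (.pair m (.mac m (.var (k + 2)))) .nil
  PGot c d e k t y :=
    .mat (.snd y) (.mac (.fst y) (.var k)) <|
    .mat (.var t) (.fst (.snd (.dec (.fst y) (.var e)))) <|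
    .nu <|
    let m : Msg :=
      .enc (.pair (.var (t + 1)) (.pair (.fst (.dec (.fst (y.shift 1)) (.var (e + 1)))) (.var 0)))
        (.var (e + 1))
    .out (.var (c + 1)) (.pair m (.mac m (.var (k + 1)))) .nil
  IsReply e k N y := ∃ r s,
    y = .pair (.enc (.pair r (.pair N s)) (.var e))
      (.mac (.enc (.pair r (.pair N s)) (.var e)) (.var k))
  V_ren r c d e k := by
    simp [verifier, Proc.ren, Proc.subst, liftSubst_var, Msg.subst, liftRen]
  P_ren r c d e k := by
    simp [prover, Proc.ren, Proc.subst, liftSubst_var, Msg.subst, liftRen]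
  PWait_ren r c d e k t := by
    simp [Proc.ren, Proc.subst, liftSubst_var, Msg.subst, liftRen]
  V_inv h := by
    cases h
    exact ⟨_, _, rfl, rfl, rfl⟩
  V_inp c d e k N := .inp N (.refl _)
  VGot_inv h := by
    cases h with
    | ext h => cases h with
      | ext h => cases h with
        | out l h => exact ⟨_, _, _, rfl, _, _, rfl⟩
  VGot_out c e k N := by
    have hN : N.shift 2 = (N.shift 1).shift 1 := (Msg.shift_shift 1 1 N).symm
    refine ⟨2, _, ?_, fun l => .ext (.ext (.out l (.refl _)))⟩
    rw [hN]
    exact ⟨.var 1, .var 0, rfl⟩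
  P_inv {c d e k π u A} h := by
    cases h with
    | ext h =>
      cases π <;> cases h
      exact ⟨_, _, rfl, rfl⟩
  P_out c d e k l := .ext (.out l (.refl _))
  PWait_inv h := by
    cases h
    exact ⟨_, _, rfl, rfl⟩
  PWait_inp c d e k t N := .inp N (.refl _)
  PGot_out := by
    rintro c d e k t _ ⟨r, s, rfl⟩
    refine ⟨1, _, fun l => .mat (.mat (.ext (.out l (.refl _))) ?_) ?_⟩
    · refine .symm (.trans (.fst (.snd (.dec (.fst_pair _ _) (.refl _)))) ?_)
      exact .trans (.fst (.trans (.snd (.dec_enc _ _)) (.snd_pair _ _))) (.fst_pair _ _)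
    · exact .trans (.snd_pair _ _) (.mac (.symm (.fst_pair _ _)) (.refl _))
  PGot_var h := by
    cases h with
    | mat _ h => simpa [Msg.nf] using h.nf_eq
  PGot_of_ne := by
    rintro c d e k t e' k' N _ π u A ⟨r, s, rfl⟩ hk h
    cases h with
    | mat _ h => exact hk (by simpa [Msg.nf] using h.nf_eq)

/-- The Feldhofer protocol. It has a single key, so that the parameter `e` is void. -/
def feldhofer : Protocol where
  keys := 1
  keys_pos := by simp
  V c d _ k := verifierF c d k
  VGot c _ k N := (Proc.nu <|
    .out (.var (c + 2)) (.enc (.pair (.var 0) (.var 1)) (.var (k + 2))) .nil).subst (instSubst N)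
  P c d _ k := proverF c d k
  PWait c d _ k t := .inp (.var d) <|
    .mat (.var (t + 1)) (.snd (.dec (.var 0) (.var (k + 1)))) <|
    .out (.var (c + 1))
      (.enc (.pair (.var (t + 1)) (.fst (.dec (.var 0) (.var (k + 1))))) (.var (k + 1))) .nil
  PGot c d _ k t y :=
    .mat (.var t) (.snd (.dec y (.var k))) <|
    .out (.var c) (.enc (.pair (.var t) (.fst (.dec y (.var k)))) (.var k)) .nil
  IsReply _ k N y := ∃ r, y = .enc (.pair r N) (.var k)
  V_ren r c d _ k := by
    simp [verifierF, Proc.ren, Proc.subst, liftSubst_var, Msg.subst, liftRen]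
  P_ren r c d _ k := by
    simp [proverF, Proc.ren, Proc.subst, liftSubst_var, Msg.subst, liftRen]
  PWait_ren r c d _ k t := by
    simp [Proc.ren, Proc.subst, liftSubst_var, Msg.subst, liftRen]
  V_inv h := by
    cases h
    exact ⟨_, _, rfl, rfl, rfl⟩
  V_inp c d _ k N := .inp N (.refl _)
  VGot_inv h := by
    cases h with
    | ext h => cases h with
      | out l h => exact ⟨_, _, _, rfl, _, rfl⟩
  VGot_out c _ k N := ⟨1, _, ⟨.var 0, rfl⟩, fun l => .ext (.out l (.refl _))⟩
  P_inv {c d e k π u A} h := by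
    cases h with
    | ext h =>
      cases π <;> cases h
      exact ⟨_, _, rfl, rfl⟩
  P_out c d _ k l := .ext (.out l (.refl _))
  PWait_inv h := by
    cases h
    exact ⟨_, _, rfl, rfl⟩
  PWait_inp c d _ k t N := .inp N (.refl _)
  PGot_out := by
    rintro c d e k t _ ⟨r, rfl⟩
    refine ⟨0, _, fun l => .mat (.out l (.refl _)) (.symm ?_)⟩
    exact .trans (.snd (.dec_enc _ _)) (.snd_pair _ _)
  PGot_var h := by
    cases h with
    | mat _ h => simpa [Msg.nf] using h.nf_eq
  PGot_of_ne := by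
    rintro c d e k t e' k' N _ π u A ⟨r, rfl⟩ hk h
    cases h with
    | mat _ h => simpa [Msg.nf, hk] using h.nf_eq

end APi

theorem mainTheorem1 (c d : ℕ) (hcd : c ≠ d) :
    ¬ APi.HPBisimilar (APi.Ext.ofProc (APi.systemMin c d)) (APi.Ext.ofProc (APi.specMin c d)) ∧
    ¬ APi.HPBisimilar (APi.Ext.ofProc (APi.systemMinF c d)) (APi.Ext.ofProc (APi.specMinF c d)) :=
  ⟨APi.Protocol.not_bisimilar APi.bac c d, APi.Protocol.not_bisimilar APi.feldhofer c d⟩
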